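/- Let $\mathsf T$ be a \emph{big tt-category}: a symmetric monoidal triangulated category with small Hom-sets and all set-indexed coproducts whose tensor product is exact and coproduct-preserving in each variable, which is generated by a set of compact objects, and whose compact objects contain the unit $\mathbf 1$, are closed under $\otimes$, and form a rigid tensor category (every compact object has a compact dual). (Zero categories are allowed.) An \emph{idempotent algebra} is a map $\eta\colon\mathbf 1\to A$ such that $A\otimes\eta$ is an isomorphism. $\mathrm{Idem}(\mathsf T)$ is the set of isomorphism classes of idempotent algebras, ordered by $A\le B$ iff there is a map $A\to B$ compatible with the maps from $\mathbf 1$; its top element is $0$. A map of partially ordered sets is called a \emph{frame map} if it preserves arbitrary joins and finite meets, and a frame map from the open sets $\Omega(X)$ of a topological space $X$ to $\mathrm{Idem}(\mathsf T)$ is called a \emph{categorified frame}. A \emph{smashing ideal} is a localizing tensor-ideal $\mathsf S\subseteq\mathsf T$ (a triangulated subcategory closed under coproducts and under tensoring with arbitrary objects) such that $\mathsf S^\perp$ is closed under coproducts. Its \emph{corresponding idempotent algebra} is the localization $\eta\colon\mathbf 1\to A$ of the unit, i.e. $\eta$ fits in a triangle $C\to\mathbf 1\xrightarrow{\eta}A\to\Sigma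 C$ with $C\in\mathsf S$, $A\in\mathsf S^\perp$. Write $L\colon\mathsf T\to\mathsf T/\mathsf S$ for the Verdier quotient, with its induced triangulated and symmetric monoidal structure. (1) Let $\mathsf S$ be a smashing ideal of $\mathsf T$ with corresponding idempotent algebra $A$. Then $\mathsf T/\mathsf S$ is again a big tt-category, and $$[A,0]=\{B\in\mathrm{Idem}(\mathsf T)\mid A\le B\le 0\}\longrightarrow\mathrm{Idem}(\mathsf T/\mathsf S),\qquad B\mapsto L(B\otimes A),$$ is an isomorphism of partially ordered sets, preserving arbitrary joins and finite meets in both directions; that is, it is an isomorphism of frames. (2) Let $X$ be a topological space, $\tau\colon\Omega(X)\to\mathrm{Idem}(\mathsf T)$ a categorified frame, $U\subseteq X$ open with closed complement $Z$, $A$ an idempotent algebra in the class $\tau(U)$, and $\mathsf T/\tau(U)$ the quotient of $\mathsf T$ by the ideal $\{M\mid A\otimes M=0\}$, with quotient functor $L$. Then $\mathsf T/\tau(U)$ is a big tt-category, and there is a unique categorified frame $\tau'\colon\Omega(Z)\to\mathrm{Idem}(\mathsf T/\tau(U))$ with $\tau'(W\cap Z)=L(\tau(W)\otimes A)$ for all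 $W\in\Omega(X)$. If $\tau$ is injective, so is $\tau'$. -/

import Mathlib

open CategoryTheory Limits MonoidalCategory Pretriangulated ZeroObject

universe w v u

namespace TTGeometry

/-! ### Frame maps between partially ordered sets -/

/-- A map between partially ordered sets preserving arbitrary joins and finite meets (in particular
the bottom and top element, as the empty join and the empty meet). Between frames (the frame
structure being a property of the order) this is precisely a morphism of frames. -/
structure IsFrameMap {P Q : Type*} [PartialOrder P] [PartialOrder Q] (f : P → Q) : Prop where
  isLUB : ∀ (s : Set P) (a : P), IsLUB s a → IsLUB (f '' s) (f a)
  isGLB : ∀ (s : Set P) (a : P), s.Finite → IsGLB s a → IsGLB (f '' s) (f a)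

/-! ### Idempotent algebras -/

section Idempotent

variable {C : Type u} [Category.{v} C] [MonoidalCategory C]

variable (C) in
/-- An idempotent algebra: an object `A` with a map `η : 𝟙 ⟶ A` such that `A ⊗ η` is invertible. -/
structure IdempotentAlgebra where
  obj : C
  η : 𝟙_ C ⟶ obj
  isIso : IsIso (obj ◁ η)

namespace IdempotentAlgebra

/-- `A ≤ B` if there is a map `A ⟶ B` under the tensor unit. -/
instance : Preorder (IdempotentAlgebra C) where
  le A B := ∃ φ : A.obj ⟶ B.obj, A.η ≫ φ = B.η
  le_refl A := ⟨𝟙 _, by simp⟩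
  le_trans A B D := by
    rintro ⟨φ, hφ⟩ ⟨ψ, hψ⟩
    exact ⟨φ ≫ ψ, by rw [← Category.assoc, hφ, hψ]⟩

/-- The image of an idempotent algebra under a strong monoidal functor. -/
def map {D : Type*} [Category* D] [MonoidalCategory D] (F : C ⥤ D) [F.Monoidal]
    (A : IdempotentAlgebra C) : IdempotentAlgebra D where
  obj := F.obj A.obj
  η := Functor.LaxMonoidal.ε F ≫ F.map A.η
  isIso := by
    have := A.isIso
    have h : F.obj A.obj ◁ F.map A.η =
        Functor.LaxMonoidal.μ F A.obj (𝟙_ C) ≫ F.map (A.obj ◁ A.η) ≫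
          Functor.OplaxMonoidal.δ F A.obj A.obj := by
      rw [Functor.Monoidal.map_whiskerLeft]
      simp only [Category.assoc, Functor.Monoidal.μ_δ, Functor.Monoidal.μ_δ_assoc,
        Category.comp_id]
    have : IsIso (F.obj A.obj ◁ F.map A.η) := by rw [h]; infer_instance
    rw [MonoidalCategory.whiskerLeft_comp]
    infer_instance

lemma map_mono {D : Type*} [Category* D] [MonoidalCategory D] (F : C ⥤ D) [F.Monoidal]
    {A B : IdempotentAlgebra C} (h : A ≤ B) : A.map F ≤ B.map F := by
  obtain ⟨φ, hφ⟩ := h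
  exact ⟨F.map φ, by simp [map, ← hφ]⟩

variable [SymmetricCategory C]

lemma isIso_whiskerRight_iff {X Y : C} (A : C) (f : X ⟶ Y) :
    IsIso (f ▷ A) ↔ IsIso (A ◁ f) := by
  have h : f ▷ A = (β_ X A).hom ≫ A ◁ f ≫ (β_ Y A).inv := by simp
  rw [h, isIso_comp_left_iff, isIso_comp_right_iff]

lemma isIso_whiskerLeft_tensor {X Y A B : C} (f : X ⟶ Y) (h : IsIso (A ◁ f) ∨ IsIso (B ◁ f)) :
    IsIso ((A ⊗ B) ◁ f) := by
  rcases h with h | h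
  · have := (isIso_whiskerRight_iff A f).2 h
    rw [← isIso_whiskerRight_iff, whiskerRight_tensor]
    infer_instance
  · rw [tensor_whiskerLeft]
    infer_instance

/-- The tensor product of two idempotent algebras. -/
def tensor (A B : IdempotentAlgebra C) : IdempotentAlgebra C where
  obj := A.obj ⊗ B.obj
  η := (λ_ (𝟙_ C)).inv ≫ (A.η ⊗ₘ B.η)
  isIso := by
    have h₁ : IsIso ((A.obj ⊗ B.obj) ◁ A.η) := isIso_whiskerLeft_tensor _ (.inl A.isIso)
    have h₂ : IsIso ((A.obj ⊗ B.obj) ◁ B.η) := isIso_whiskerLeft_tensor _ (.inr B.isIso)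
    have h₁' : IsIso ((A.obj ⊗ B.obj) ◁ (A.η ▷ 𝟙_ C)) := by
      rw [MonoidalCategory.whiskerRight_id, MonoidalCategory.whiskerLeft_comp,
        MonoidalCategory.whiskerLeft_comp]
      infer_instance
    have h₂' : IsIso ((A.obj ⊗ B.obj) ◁ (A.obj ◁ B.η)) := by
      have := isIso_whiskerLeft_tensor (B := A.obj) _ (.inl h₂)
      rw [tensor_whiskerLeft, isIso_comp_left_iff, isIso_comp_right_iff] at this
      exact this
    rw [MonoidalCategory.whiskerLeft_comp, MonoidalCategory.tensorHom_def, MonoidalCategory.whiskerLeft_comp]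
    infer_instance

lemma tensor_mono {A A' B B' : IdempotentAlgebra C} (h : A ≤ A') (h' : B ≤ B') :
    A.tensor B ≤ A'.tensor B' := by
  obtain ⟨φ, hφ⟩ := h
  obtain ⟨ψ, hψ⟩ := h'
  exact ⟨φ ⊗ₘ ψ, by simp [tensor, ← hφ, ← hψ]⟩

end IdempotentAlgebra

variable (C) in
/-- The partially ordered set `Idem(C)` of isomorphism classes of idempotent algebras
(`A` and `B` are isomorphic under the unit if and only if `A ≤ B` and `B ≤ A`). -/
abbrev Idem := Antisymmetrization (IdempotentAlgebra C) (· ≤ ·)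

/-- The class of an idempotent algebra. -/
def Idem.mk (A : IdempotentAlgebra C) : Idem C := toAntisymmetrization (· ≤ ·) A

/-- The map on classes of idempotent algebras induced by a strong monoidal functor. -/
def Idem.map {D : Type*} [Category* D] [MonoidalCategory D] (F : C ⥤ D) [F.Monoidal] :
    Idem C → Idem D :=
  Quotient.map (IdempotentAlgebra.map F) fun _ _ h ↦
    ⟨IdempotentAlgebra.map_mono F h.1, IdempotentAlgebra.map_mono F h.2⟩

variable [SymmetricCategory C]

/-- The tensor product on classes of idempotent algebras. -/
def Idem.tensor : Idem C → Idem C → Idem C :=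
  Quotient.map₂ IdempotentAlgebra.tensor fun _ _ h _ _ h' ↦
    ⟨IdempotentAlgebra.tensor_mono h.1 h'.1, IdempotentAlgebra.tensor_mono h.2 h'.2⟩

end Idempotent

/-! ### Tensor triangulated categories -/

section TT

variable (T : Type u) [Category.{v} T] [Preadditive T] [HasZeroObject T] [HasShift T ℤ]
  [∀ n : ℤ, (shiftFunctor T n).Additive] [Pretriangulated T]

/-- The tensor product is an exact functor in each variable: it commutes with the shift up to
a natural isomorphism in such a way that distinguished triangles are preserved. -/
class IsTensorTriangulated [MonoidalCategory T] : Prop where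
  exact_left : ∀ X : T, ∃ _ : (tensorLeft X).CommShift ℤ, (tensorLeft X).IsTriangulated
  exact_right : ∀ X : T, ∃ _ : (tensorRight X).CommShift ℤ, (tensorRight X).IsTriangulated

/-- An object `t` is compact if every map from `t` to a (`w`-small) coproduct factors through
a finite subcoproduct. -/
def compactObjects [HasCoproducts.{w} T] : ObjectProperty T := fun t ↦
  ∀ (J : Type w) (M : J → T) (f : t ⟶ ∐ M), ∃ (s : Finset J) (g : t ⟶ ∐ fun j : s ↦ M j),
    f = g ≫ Sigma.desc fun j : s ↦ Sigma.ι M j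

/-- Big tt-categories, i.e. rigidly-compactly generated tensor triangulated categories; "small"
means `w`-small. Rigidity of the monoidal category of compact objects is expressed by
the existence of duals. -/
class IsBigTTCategory [MonoidalCategory T] [SymmetricCategory T] : Prop extends
    IsTriangulated T, IsTensorTriangulated T where
  locallySmall : LocallySmall.{w} T
  hasCoproducts : HasCoproducts.{w} T
  /-- The tensor product preserves coproducts in each variable. -/
  tensorLeft_preserves : ∀ (X : T) (J : Type w),
    PreservesColimitsOfShape (Discrete J) (tensorLeft X)
  tensorRight_preserves : ∀ (X : T) (J : Type w),
    PreservesColimitsOfShape (Discrete J) (tensorRight X)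
  /-- There is a set of compact generators. -/
  compactlyGenerated : ∃ (ι : Type w) (G : ι → T), (∀ i, compactObjects.{w} T (G i)) ∧
    ∀ M : T, IsZero M ↔ ∀ (i : ι) (n : ℤ) (f : G i ⟶ M⟦n⟧), f = 0
  /-- The compact objects form a tensor subcategory (containing the unit). -/
  compact_isMonoidal : (compactObjects.{w} T).IsMonoidal
  /-- The tensor category of compact objects is rigid. -/
  compact_rigid : ∀ c : T, compactObjects.{w} T c →
    ∃ d : T, compactObjects.{w} T d ∧ Nonempty (ExactPairing c d)

end TT

section Ideals

variable {T : Type u} [Category.{v} T] [Preadditive T] [HasZeroObject T] [HasShift T ℤ]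
  [∀ n : ℤ, (shiftFunctor T n).Additive] [Pretriangulated T]
  [MonoidalCategory T]

/-- A full subcategory is a tensor-ideal if it is closed under tensoring with arbitrary objects. -/
class IsTensorIdeal (S : ObjectProperty T) : Prop where
  tensor_mem : ∀ (X Y : T), S Y → S (X ⊗ Y)

/-- A (triangulated) tensor-ideal `S` is a smashing ideal if it is localizing and its right
orthogonal is closed under coproducts. As `S` is closed under shifts, its right orthogonal is
the full subcategory of all `N` such that every map from an object of `S` to a shift of
`N` vanishes. -/
structure IsSmashing (S : ObjectProperty T) [S.IsTriangulated] [IsTensorIdeal S] : Prop where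
  localizing : ∀ J : Type w, S.IsClosedUnderColimitsOfShape (Discrete J)
  orthogonal : ∀ J : Type w, S.rightOrthogonal.IsClosedUnderColimitsOfShape (Discrete J)

/-- `A` is the idempotent algebra corresponding to `S`: the unit `η : 𝟙 ⟶ A` is the localization
of the tensor unit, i.e. there is a triangle `C ⟶ 𝟙 ⟶ A ⟶ C⟦1⟧` with `C` in `S` and
`A` in the right orthogonal of `S`. -/
def IdempotentAlgebra.Corresponds (A : IdempotentAlgebra T) (S : ObjectProperty T) : Prop :=
  S.rightOrthogonal A.obj ∧ ∃ (C : T) (ε : C ⟶ 𝟙_ T) (δ : A.obj ⟶ C⟦(1 : ℤ)⟧),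
    S C ∧ Triangle.mk ε A.η δ ∈ distTriang T

/-- The ideal of objects annihilated by `A`; this is the smashing ideal to which `A` corresponds. -/
def IdempotentAlgebra.annihilator (A : IdempotentAlgebra T) : ObjectProperty T :=
  fun X ↦ IsZero (A.obj ⊗ X)

section

variable [IsTensorTriangulated T]

lemma isZero_tensor_right (X : T) {Y : T} (h : IsZero Y) : IsZero (X ⊗ Y) := by
  obtain ⟨_, _⟩ := IsTensorTriangulated.exact_left X
  exact (tensorLeft X).map_isZero h

variable (T) in
/-- The zero algebra. -/
noncomputable def IdempotentAlgebra.zero : IdempotentAlgebra T where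
  obj := 0
  η := 0
  isIso := by
    obtain ⟨_, _⟩ := IsTensorTriangulated.exact_right (0 : T)
    have h (X : T) : IsZero ((0 : T) ⊗ X) := by
      obtain ⟨_, _⟩ := IsTensorTriangulated.exact_right X
      exact (tensorRight X).map_isZero (isZero_zero T)
    exact ⟨0, (h _).eq_of_src _ _, (h _).eq_of_src _ _⟩

instance (A : IdempotentAlgebra T) : A.annihilator.IsClosedUnderIsomorphisms where
  of_iso e h := IsZero.of_iso h (whiskerLeftIso A.obj e.symm)

instance (A : IdempotentAlgebra T) : A.annihilator.IsTriangulated := by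
  obtain ⟨_, _⟩ := IsTensorTriangulated.exact_left A.obj
  exact
    { exists_zero := ⟨0, isZero_zero T, isZero_tensor_right _ (isZero_zero T)⟩
      isStableUnderShiftBy n := ⟨fun X hX ↦
        ((shiftFunctor T n).map_isZero hX).of_iso (((tensorLeft A.obj).commShiftIso n).app X)⟩
      toIsTriangulatedClosed₂ := .mk' fun Δ hΔ h₁ h₃ ↦
        Triangle.isZero₂_of_isZero₁₃ _ ((tensorLeft A.obj).map_distinguished Δ hΔ) h₁ h₃ }

instance [SymmetricCategory T] (A : IdempotentAlgebra T) : IsTensorIdeal A.annihilator where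
  tensor_mem X Y h := (isZero_tensor_right X h).of_iso
    ((α_ _ _ _).symm ≪≫ whiskerRightIso (β_ A.obj X) Y ≪≫ α_ _ _ _)

variable [IsTriangulated T] [SymmetricCategory T]

/-- Morphisms with cone in a tensor-ideal are stable under tensoring. -/
instance trW_isMonoidal (S : ObjectProperty T) [S.IsTriangulated] [IsTensorIdeal S] :
    S.trW.IsMonoidal := by
  have key : ∀ (X : T) {Y₁ Y₂ : T} (g : Y₁ ⟶ Y₂), S.trW g → S.trW (X ◁ g) := by
    rintro X Y₁ Y₂ g ⟨Z, a, b, hT, hZ⟩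
    obtain ⟨_, _⟩ := IsTensorTriangulated.exact_left X
    exact ⟨_, _, _, (tensorLeft X).map_distinguished _ hT, IsTensorIdeal.tensor_mem X Z hZ⟩
  exact
    { whiskerLeft := fun X _ _ g hg ↦ key X g hg
      whiskerRight := fun {X₁ X₂} f hf Y ↦
        (S.trW.arrow_mk_iso_iff
          (Arrow.isoMk (β_ X₁ Y) (β_ X₂ Y) (by simp))).2 (key Y f hf) }

/-! ### The tensor triangulated Verdier quotient -/

/-- The Verdier quotient `T/S`: the localization of `T` at the morphisms with cone in `S`,
with its localized shift, triangulation and symmetric tensor product. -/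
def TTQuotient (S : ObjectProperty T) [S.IsTriangulated] [IsTensorIdeal S] : Type u :=
  LocalizedMonoidal S.trW.Q S.trW (Iso.refl _)

namespace TTQuotient

variable (S : ObjectProperty T) [S.IsTriangulated] [IsTensorIdeal S]

noncomputable instance : Category.{max u v} (TTQuotient S) :=
  inferInstanceAs (Category (LocalizedMonoidal S.trW.Q S.trW (Iso.refl _)))

noncomputable instance : Preadditive (TTQuotient S) :=
  inferInstanceAs (Preadditive S.trW.Localization)

instance : HasZeroObject (TTQuotient S) :=
  inferInstanceAs (HasZeroObject S.trW.Localization)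

noncomputable instance : HasShift (TTQuotient S) ℤ :=
  inferInstanceAs (HasShift S.trW.Localization ℤ)

instance (n : ℤ) : (shiftFunctor (TTQuotient S) n).Additive :=
  inferInstanceAs (shiftFunctor S.trW.Localization n).Additive

noncomputable instance : Pretriangulated (TTQuotient S) :=
  inferInstanceAs (Pretriangulated S.trW.Localization)

noncomputable instance : MonoidalCategory (TTQuotient S) :=
  inferInstanceAs (MonoidalCategory (LocalizedMonoidal S.trW.Q S.trW (Iso.refl _)))

noncomputable instance : SymmetricCategory (TTQuotient S) :=
  inferInstanceAs (SymmetricCategory (LocalizedMonoidal S.trW.Q S.trW (Iso.refl _)))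

/-- The localization functor `T ⥤ T/S`. -/
noncomputable def functor : T ⥤ TTQuotient S :=
  Localization.Monoidal.toMonoidalCategory S.trW.Q S.trW (Iso.refl _)

instance : (functor S).IsLocalization S.trW :=
  inferInstanceAs (S.trW.Q.IsLocalization S.trW)

noncomputable instance : (functor S).CommShift ℤ :=
  inferInstanceAs (S.trW.Q.CommShift ℤ)

instance : (functor S).IsTriangulated :=
  inferInstanceAs (S.trW.Q.IsTriangulated)

noncomputable instance : (functor S).Braided :=
  inferInstanceAs
    (Localization.Monoidal.toMonoidalCategory S.trW.Q S.trW (Iso.refl _)).Braided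

end TTQuotient

end

end Ideals

end TTGeometry

open TTGeometry TopologicalSpace

/-! The heart of the matter is that a smashing ideal `S` is annihilated by its algebra `A`
(`IsSmashing.le_annihilator`). The objects `X` with `A ⊗ X` local form a localizing subcategory,
since local objects are closed under coproducts, and it contains each compact `c`, since Hom(Y, A ⊗
c) = Hom(Y ⊗ c^∨, A) = 0 for `Y` in `S`. So for `Y` in `S` the object `A ⊗ Y` is both local and in
`S`, hence zero. Therefore `X ⟶ A ⊗ X` is the localization of `X`, every object of `T/S` comes from
a local one, and maps into local objects are the same in `T` and in `T/S`. Smallness, coproducts and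
compact generators are transported in this way.

Rigidity of `T/S` needs no description of its compact objects: if the compact generators are
dualizable and the unit is compact, then all compact objects are dualizable
(`IsCompactlyGenerating.exists_dual`). Brown representability, in the form of a telescope of cell
attachments (`exists_cellular_approximation`), gives a candidate dual; dévissage to the generators
in both variables shows that it is one.

The tensor product is the join in `Idem`, so `B ⊗ A = B` for `B ≥ A`. Such a `B` is local, so `L`
preserves and reflects the order above `A`; object and unit of an idempotent algebra of `T/S` lift
to a local object, which gives surjectivity. For the second part, opens of `Z` correspond to opens
of `X` containing `U` by `V ↦ V ∪ U`, and `τ' V` is the image of `τ (V ∪ U)`. -/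

namespace TTGeometry

universe v₁ v₂ u₁ u₂

/-! ### Coproducts and compact objects -/

section Coproducts

variable {K : Type u₁} [Category.{v₁} K] {D : Type u₂} [Category.{v₂} D]

/-- The maps `ι j : M j ⟶ X` exhibit `X` as a coproduct. -/
def IsCoproduct {J : Type w} {M : J → K} {X : K} (ι : ∀ j, M j ⟶ X) : Prop :=
  ∀ ⦃Y : K⦄ (f : ∀ j, M j ⟶ Y), ∃! g : X ⟶ Y, ∀ j, ι j ≫ g = f j

namespace IsCoproduct

variable {J : Type w} {M : J → K} {X : K} {ι : ∀ j, M j ⟶ X}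

lemma hom_ext (h : IsCoproduct ι) {Y : K} {f g : X ⟶ Y} (hfg : ∀ j, ι j ≫ f = ι j ≫ g) : f = g :=
  (h fun j ↦ ι j ≫ g).unique hfg fun _ ↦ rfl

lemma exists_desc (h : IsCoproduct ι) {Y : K} (f : ∀ j, M j ⟶ Y) :
    ∃ g : X ⟶ Y, ∀ j, ι j ≫ g = f j :=
  (h f).exists

lemma of_isColimit (h : IsColimit (Cofan.mk X ι)) : IsCoproduct ι := fun _ f ↦
  ⟨Cofan.IsColimit.desc h f, fun j ↦ Cofan.IsColimit.fac h f j, fun _ hg ↦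
    Cofan.IsColimit.hom_ext h _ _ fun j ↦ (hg j).trans (Cofan.IsColimit.fac h f j).symm⟩

lemma sigma (M : J → K) [HasCoproduct M] : IsCoproduct (Sigma.ι M) :=
  of_isColimit (coproductIsCoproduct M)

lemma isColimit (h : IsCoproduct ι) : Nonempty (IsColimit (Cofan.mk X ι)) :=
  ⟨Cofan.IsColimit.mk _ (fun t ↦ (h.exists_desc t.inj).choose)
    (fun t ↦ (h.exists_desc t.inj).choose_spec)
    fun t _ hm ↦ h.hom_ext fun j ↦ (hm j).trans ((h.exists_desc t.inj).choose_spec j).symm⟩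

lemma map (h : IsCoproduct ι) (F : K ⥤ D) [PreservesColimitsOfShape (Discrete J) F] :
    IsCoproduct fun j ↦ F.map (ι j) :=
  of_isColimit (isColimitCofanMkObjOfIsColimit F _ _ h.isColimit.some)

lemma prop (h : IsCoproduct ι) (P : ObjectProperty K)
    [P.IsClosedUnderColimitsOfShape (Discrete J)] (hM : ∀ j, P (M j)) : P X :=
  P.prop_of_isColimit h.isColimit.some fun j ↦ hM j.as

lemma of_cofan {F : Discrete J ⥤ K} {c : Cocone F} (hc : IsColimit c) :
    IsCoproduct fun j : J ↦ c.ι.app ⟨j⟩ := fun _ f ↦ by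
  refine ⟨hc.desc ⟨_, Discrete.natTrans fun j ↦ f j.as⟩, fun j ↦ hc.fac _ _, fun g hg ↦ ?_⟩
  exact hc.hom_ext fun j ↦ (hg j.as).trans (hc.fac ⟨_, Discrete.natTrans fun j ↦ f j.as⟩ j).symm

end IsCoproduct

lemma isClosedUnderColimitsOfShape_of_isCoproduct (P : ObjectProperty K) (J : Type w)
    (h : ∀ (M : J → K) (X : K) (ι : ∀ j, M j ⟶ X), IsCoproduct ι → (∀ j, P (M j)) → P X) :
    P.IsClosedUnderColimitsOfShape (Discrete J) where
  colimitsOfShape_le := by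
    rintro X ⟨c⟩
    exact h _ _ _ (.of_cofan c.isColimit) fun j ↦ c.prop_diag_obj ⟨j⟩

/-- An isomorphism exhibits its target as a coproduct of a one-element family. -/
lemma isClosedUnderIsomorphisms_of_coproducts (P : ObjectProperty K)
    [P.IsClosedUnderColimitsOfShape (Discrete PUnit.{w + 1})] : P.IsClosedUnderIsomorphisms where
  of_iso {X Y} e hX := by
    refine IsCoproduct.prop (J := PUnit.{w + 1}) (M := fun _ ↦ X) (ι := fun _ ↦ e.hom)
      (fun Z f ↦ ?_) P fun _ ↦ hX
    exact ⟨e.inv ≫ f ⟨⟩, fun j ↦ by simp, fun g hg ↦ by simp [← hg ⟨⟩]⟩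

end Coproducts

section Compact

variable {K : Type u₁} [Category.{v₁} K] [Preadditive K] [HasZeroObject K] [HasShift K ℤ]
  [∀ n : ℤ, (shiftFunctor K n).Additive] [Pretriangulated K] [HasCoproducts.{w} K]

/-- The identity of a finite coproduct is the sum of the projections followed by the inclusions, so
a factorization through a finite subcoproduct amounts to a finite sum. This form works for any
coproduct, not only the chosen one. -/
lemma compactObjects_iff (t : K) : compactObjects.{w} K t ↔
    ∀ (J : Type w) (M : J → K) (X : K) (ι : ∀ j, M j ⟶ X), IsCoproduct ι → ∀ f : t ⟶ X,
      ∃ (s : Finset J) (g : ∀ j, t ⟶ M j), f = ∑ j ∈ s, g j ≫ ι j := by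
  classical
  refine ⟨fun ht J M X ι hι f ↦ ?_, fun ht J M f ↦ ?_⟩
  · obtain ⟨φ, hφ⟩ := hι.exists_desc (Sigma.ι M)
    obtain ⟨s, g, hg⟩ := ht J M (f ≫ φ)
    obtain ⟨ψ, hψ⟩ := (IsCoproduct.sigma M).exists_desc ι
    have hφψ : φ ≫ ψ = 𝟙 X := hι.hom_ext fun j ↦ by simp [reassoc_of% hφ, hψ]
    have key : ∀ s : Finset J, ∃ π : ∀ j, (∐ fun j : s ↦ M j) ⟶ M j,
        𝟙 _ = ∑ j ∈ s.attach, π j ≫ Sigma.ι (fun j : s ↦ M j) j := by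
      intro s
      refine ⟨fun j ↦ Sigma.desc fun i : s ↦
        if h : (i : J) = j then eqToHom (by rw [h]) else 0, ?_⟩
      refine Sigma.hom_ext _ _ fun i ↦ ?_
      rw [Category.comp_id, Preadditive.comp_sum, Finset.sum_eq_single i]
      · simp
      · intro j _ hj
        simp [Ne.symm hj]
      · simp
    obtain ⟨π, hπ⟩ := key s
    refine ⟨s, fun j ↦ g ≫ π j, ?_⟩
    have : f = g ≫ 𝟙 _ ≫ Sigma.desc fun j : s ↦ ι j := by
      rw [← Category.comp_id f, ← hφψ, ← Category.assoc, hg, Category.id_comp, Category.assoc]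
      congr 1
      exact Sigma.hom_ext _ _ fun j ↦ by simp [hψ]
    rw [this, hπ, Preadditive.sum_comp, Preadditive.comp_sum, ← Finset.sum_attach s]
    simp
  · obtain ⟨s, g, hg⟩ := ht J M _ _ (.sigma M) f
    refine ⟨s, ∑ j ∈ s.attach, g j ≫ Sigma.ι (fun j : s ↦ M j) j, ?_⟩
    rw [hg, Preadditive.sum_comp, ← Finset.sum_attach s]
    simp

lemma compactObjects_of_iso {t t' : K} (e : t ≅ t') (ht : compactObjects.{w} K t) :
    compactObjects.{w} K t' := by
  intro J M f
  obtain ⟨s, g, hg⟩ := ht J M (e.hom ≫ f)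
  exact ⟨s, e.inv ≫ g, by rw [Category.assoc, ← hg, e.inv_hom_id_assoc]⟩

/-- A left adjoint preserves compact objects if its right adjoint preserves coproducts. -/
lemma compactObjects_obj_of_adjunction {D : Type u₂} [Category.{v₂} D] [Preadditive D]
    [HasZeroObject D] [HasShift D ℤ] [∀ n : ℤ, (shiftFunctor D n).Additive] [Pretriangulated D]
    [HasCoproducts.{w} D] {F : K ⥤ D} {R : D ⥤ K} (adj : F ⊣ R) [F.Additive]
    (hR : ∀ J : Type w, PreservesColimitsOfShape (Discrete J) R) {t : K}
    (ht : compactObjects.{w} K t) : compactObjects.{w} D (F.obj t) := by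
  rw [compactObjects_iff] at ht ⊢
  intro J M X ι hι f
  have := hR J
  obtain ⟨s, g, hg⟩ := ht J _ _ _ (hι.map R) (adj.homEquiv _ _ f)
  refine ⟨s, fun j ↦ (adj.homEquiv _ _).symm (g j), ?_⟩
  apply (adj.homEquiv _ _).injective
  rw [hg]
  apply (adj.homEquiv _ _).symm.injective
  simp [Adjunction.homEquiv_counit, Functor.map_sum, Preadditive.sum_comp]

lemma compactObjects_shift {t : K}
    (ht : compactObjects.{w} K t) (n : ℤ) : compactObjects.{w} K (t⟦n⟧) :=
  have adj : shiftFunctor K n ⊣ shiftFunctor K (-n) := (shiftEquiv K n).toAdjunction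
  compactObjects_obj_of_adjunction adj (fun _ ↦ inferInstance) ht

end Compact

/-! ### Exactness of distinguished triangles in terms of their components -/

section Exactness

variable {K : Type u₁} [Category.{v₁} K] [Preadditive K] [HasZeroObject K] [HasShift K ℤ]
  [∀ n : ℤ, (shiftFunctor K n).Additive] [Pretriangulated K]
  {X Y Z : K} {f : X ⟶ Y} {g : Y ⟶ Z} {h : Z ⟶ X⟦(1 : ℤ)⟧}

namespace DistTriang

lemma comp₁₂ (hT : Triangle.mk f g h ∈ distTriang K) : f ≫ g = 0 :=
  comp_distTriang_mor_zero₁₂ _ hT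

lemma comp₃₁ (hT : Triangle.mk f g h ∈ distTriang K) : h ≫ f⟦(1 : ℤ)⟧' = 0 :=
  comp_distTriang_mor_zero₃₁ _ hT

lemma yoneda₂ (hT : Triangle.mk f g h ∈ distTriang K) {V : K} (a : Y ⟶ V) (ha : f ≫ a = 0) :
    ∃ b : Z ⟶ V, a = g ≫ b :=
  Triangle.yoneda_exact₂ _ hT a ha

lemma yoneda₃ (hT : Triangle.mk f g h ∈ distTriang K) {V : K} (a : Z ⟶ V) (ha : g ≫ a = 0) :
    ∃ b : X⟦(1 : ℤ)⟧ ⟶ V, a = h ≫ b :=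
  Triangle.yoneda_exact₃ _ hT a ha

lemma coyoneda₂ (hT : Triangle.mk f g h ∈ distTriang K) {V : K} (a : V ⟶ Y) (ha : a ≫ g = 0) :
    ∃ b : V ⟶ X, a = b ≫ f :=
  Triangle.coyoneda_exact₂ _ hT a ha

lemma coyoneda₃ (hT : Triangle.mk f g h ∈ distTriang K) {V : K} (a : V ⟶ Z) (ha : a ≫ h = 0) :
    ∃ b : V ⟶ Y, a = b ≫ g :=
  Triangle.coyoneda_exact₃ _ hT a ha

lemma map_functor (hT : Triangle.mk f g h ∈ distTriang K) {D : Type u₂} [Category.{v₂} D] [Preadditive D]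
    [HasZeroObject D] [HasShift D ℤ] [∀ n : ℤ, (shiftFunctor D n).Additive] [Pretriangulated D]
    (Φ : K ⥤ D) [Φ.CommShift ℤ] [Φ.IsTriangulated] :
    Triangle.mk (Φ.map f) (Φ.map g) (Φ.map h ≫ (Φ.commShiftIso (1 : ℤ)).hom.app X) ∈
      distTriang D :=
  Φ.map_distinguished _ hT

lemma rotate (hT : Triangle.mk f g h ∈ distTriang K) :
    Triangle.mk g h (-f⟦(1 : ℤ)⟧') ∈ distTriang K :=
  rot_of_distTriang _ hT

variable {D : Type u₂} [Category.{v₂} D] [Preadditive D]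
  [HasZeroObject D] [HasShift D ℤ] [∀ n : ℤ, (shiftFunctor D n).Additive] [Pretriangulated D]
  (Φ : K ⥤ D) [Φ.CommShift ℤ] [Φ.IsTriangulated]

/-- Only the first two maps of a rotated triangle enter here and below, so `commShiftIso` never
appears in the five lemma arguments. -/
lemma map_yoneda₂ (hT : Triangle.mk f g h ∈ distTriang K) {V : D} (a : Φ.obj Y ⟶ V)
    (ha : Φ.map f ≫ a = 0) : ∃ b : Φ.obj Z ⟶ V, a = Φ.map g ≫ b :=
  yoneda₂ (map_functor hT Φ) a ha

lemma map_yoneda₃ (hT : Triangle.mk f g h ∈ distTriang K) {V : D} (a : Φ.obj Z ⟶ V)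
    (ha : Φ.map g ≫ a = 0) : ∃ b : Φ.obj (X⟦(1 : ℤ)⟧) ⟶ V, a = Φ.map h ≫ b :=
  map_yoneda₂ Φ (rotate hT) a ha

lemma map_yoneda₁ (hT : Triangle.mk f g h ∈ distTriang K) {V : D} (a : Φ.obj (X⟦(1 : ℤ)⟧) ⟶ V)
    (ha : Φ.map h ≫ a = 0) :
    ∃ b : Φ.obj (Y⟦(1 : ℤ)⟧) ⟶ V, a = Φ.map (f⟦(1 : ℤ)⟧') ≫ b := by
  obtain ⟨b, hb⟩ := map_yoneda₂ Φ (rotate (rotate hT)) a ha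
  -- The second map of the twice rotated triangle is `-f⟦1⟧'`; `b` absorbs the sign.
  exact ⟨-b, by rw [hb, Φ.map_neg, Preadditive.neg_comp, Preadditive.comp_neg]⟩

lemma map_coyoneda₂ (hT : Triangle.mk f g h ∈ distTriang K) {V : D} (a : V ⟶ Φ.obj Y)
    (ha : a ≫ Φ.map g = 0) : ∃ b : V ⟶ Φ.obj X, a = b ≫ Φ.map f :=
  coyoneda₂ (map_functor hT Φ) a ha

lemma map_coyoneda₃ (hT : Triangle.mk f g h ∈ distTriang K) {V : D} (a : V ⟶ Φ.obj Z)
    (ha : a ≫ Φ.map h = 0) : ∃ b : V ⟶ Φ.obj Y, a = b ≫ Φ.map g :=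
  map_coyoneda₂ Φ (rotate hT) a ha

lemma map_coyoneda₁ (hT : Triangle.mk f g h ∈ distTriang K) {V : D} (a : V ⟶ Φ.obj (X⟦(1 : ℤ)⟧))
    (ha : a ≫ Φ.map (f⟦(1 : ℤ)⟧') = 0) : ∃ b : V ⟶ Φ.obj Z, a = b ≫ Φ.map h :=
  map_coyoneda₂ Φ (rotate (rotate hT)) a (by rw [Φ.map_neg, Preadditive.comp_neg, ha, neg_zero])

end DistTriang

end Exactness

/-! ### Cellular approximations -/

section Telescope

variable {K : Type u₁} [Category.{v₁} K] [Preadditive K] [HasZeroObject K] [HasShift K ℤ]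
  [∀ n : ℤ, (shiftFunctor K n).Additive] [Pretriangulated K] [HasCoproducts.{w} K]

/-- Maps from a compact object into a coproduct which are fixed by a shift operator vanish. -/
lemma eq_zero_of_comp_shift_eq {t : K} (ht : compactObjects.{w} K t) {Y : ℕ → K}
    (x : ∀ n, Y n ⟶ Y (n + 1)) {X : K} {ι : ∀ n : ULift.{w} ℕ, Y n.down ⟶ X} (hι : IsCoproduct ι)
    (s : X ⟶ X) (hs : ∀ n, ι ⟨n⟩ ≫ s = x n ≫ ι ⟨n + 1⟩) (g : t ⟶ X) (hg : g ≫ s = g) :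
    g = 0 := by
  -- `τ N` projects to the summands of index `< N`. As `s` raises the index by one, `g = g ≫ s`
  -- forces `g ≫ τ N = 0` by induction, while `g ≫ τ N = g` for large `N` by compactness.
  choose τ hτ using fun N : ℕ ↦ hι.exists_desc fun n ↦ if n.down < N then ι n else 0
  have hτs : ∀ N, s ≫ τ (N + 1) = τ N ≫ s := by
    refine fun N ↦ hι.hom_ext fun ⟨n⟩ ↦ ?_
    rw [← Category.assoc, hs, Category.assoc, hτ, ← Category.assoc, hτ]
    by_cases h : n < N <;> simp [h, hs]
  have hgτ : ∀ N, g ≫ τ N = 0 := by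
    intro N
    induction N with
    | zero =>
      have : τ 0 = 0 := hι.hom_ext fun n ↦ by simp [hτ]
      simp [this]
    | succ N ih => rw [← hg, Category.assoc, hτs, ← Category.assoc, ih, zero_comp]
  obtain ⟨S, h, hh⟩ := (compactObjects_iff t).1 ht _ _ _ ι hι g
  obtain ⟨N, hN⟩ := (S.image ULift.down).exists_nat_subset_range
  have : g ≫ τ N = g := by
    rw [hh, Preadditive.sum_comp]
    refine Finset.sum_congr rfl fun n hn ↦ ?_
    have : n.down < N := Finset.mem_range.1 (hN (Finset.mem_image_of_mem _ hn))
    rw [Category.assoc, hτ, if_pos this]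
  rw [← this, hgτ]

variable {D : Type u₂} [Category.{v₂} D] [Preadditive D] [HasZeroObject D] [HasShift D ℤ]
  [∀ n : ℤ, (shiftFunctor D n).Additive] [Pretriangulated D] [LocallySmall.{w} K]

variable (P : ObjectProperty K) [P.IsTriangulated] [P.IsClosedUnderIsomorphisms]
  [∀ J : Type w, P.IsClosedUnderColimitsOfShape (Discrete J)]
  {I : Type w} {G : I → K}
  (Φ : K ⥤ D) [Φ.CommShift ℤ] [Φ.IsTriangulated]
  [∀ J : Type w, PreservesColimitsOfShape (Discrete J) Φ] (W : D)


/-- Kill all maps from the objects `G i` to `X` in the kernel of the transformation given by `e`. -/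
lemma exists_kill_kernel (hPG : ∀ i, P (G i)) {X : K} (hX : P X) (e : Φ.obj X ⟶ W) :
    ∃ (X' : K) (x : X ⟶ X') (e' : Φ.obj X' ⟶ W), P X' ∧ Φ.map x ≫ e' = e ∧
      ∀ i (f : G i ⟶ X), Φ.map f ≫ e = 0 → f ≫ x = 0 := by
  -- `X'` will be the cone of the sum of all maps to be killed; `Shrink` keeps the index set
  -- `w`-small.
  let J : Type w := Σ i, Shrink.{w} {f : G i ⟶ X // Φ.map f ≫ e = 0}
  let m : ∀ j : J, G j.1 ⟶ X := fun j ↦ ((equivShrink _).symm j.2).1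
  let ι := Sigma.ι fun j : J ↦ G j.1
  have hι : IsCoproduct ι := .sigma _
  obtain ⟨a, ha⟩ := hι.exists_desc m
  obtain ⟨X', x, δ, hT⟩ := distinguished_cocone_triangle a
  have hX' : P X' := P.ext_of_isTriangulatedClosed₃ _ hT (hι.prop P fun j ↦ hPG j.1) hX
  have hae : Φ.map a ≫ e = 0 := (hι.map Φ).hom_ext fun j ↦ by
    rw [← Category.assoc, ← Φ.map_comp, ha, comp_zero]
    exact ((equivShrink _).symm j.2).2
  obtain ⟨e', he'⟩ := DistTriang.yoneda₂ (DistTriang.map_functor hT Φ) e hae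
  refine ⟨X', x, e', hX', he'.symm, fun i f hf ↦ ?_⟩
  have h := ha ⟨i, equivShrink _ ⟨f, hf⟩⟩
  have : f = m ⟨i, equivShrink _ ⟨f, hf⟩⟩ := by simp [m]
  rw [this, ← h, Category.assoc]
  rw [DistTriang.comp₁₂ hT, comp_zero]

variable [LocallySmall.{w} D]

/-- Brown representability for the functor `V ↦ (Φ V ⟶ W)` on the objects `G i`: the representing
object may be chosen in any localizing subcategory containing the compact objects `G i`. -/
theorem exists_cellular_approximation (hG : ∀ i, compactObjects.{w} K (G i))
    (hPG : ∀ i, P (G i)) :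
    ∃ (X : K) (ε : Φ.obj X ⟶ W), P X ∧
      ∀ i, Function.Bijective fun f : G i ⟶ X ↦ Φ.map f ≫ ε := by
  choose! F x E hF hE hkill using
    fun (X : K) (hX : P X) (e : Φ.obj X ⟶ W) ↦ exists_kill_kernel P Φ W hPG hX e
  -- Stage zero has one cell for each map `Φ (G i) ⟶ W`, which ensures surjectivity; each later
  -- stage kills the kernel of the preceding one.
  let J₀ : Type w := Σ i, Shrink.{w} (Φ.obj (G i) ⟶ W)
  let ι₀ := Sigma.ι fun j : J₀ ↦ G j.1
  have hι₀ : IsCoproduct ι₀ := .sigma _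
  obtain ⟨e₀, he₀⟩ := (hι₀.map Φ).exists_desc fun j ↦ (equivShrink _).symm j.2
  let Q : Type _ := Σ' X : K, Σ' _ : Φ.obj X ⟶ W, P X
  let seq : ℕ → Q := fun n ↦ Nat.rec ⟨_, e₀, hι₀.prop P fun j ↦ hPG j.1⟩
    (fun _ q ↦ ⟨F q.1 q.2.1, E q.1 q.2.1, hF q.1 q.2.2 q.2.1⟩) n
  let Y : ℕ → K := fun n ↦ (seq n).1
  let e : ∀ n, Φ.obj (Y n) ⟶ W := fun n ↦ (seq n).2.1
  have hY : ∀ n, P (Y n) := fun n ↦ (seq n).2.2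
  let y : ∀ n, Y n ⟶ Y (n + 1) := fun n ↦ x (seq n).1 (seq n).2.1
  have he : ∀ n, Φ.map (y n) ≫ e (n + 1) = e n := fun n ↦ hE _ (hY n) _
  have hy : ∀ n i (f : G i ⟶ Y n), Φ.map f ≫ e n = 0 → f ≫ y n = 0 :=
    fun n i f hf ↦ hkill _ (hY n) _ i f hf
  let ι := Sigma.ι fun n : ULift.{w} ℕ ↦ Y n.down
  have hι : IsCoproduct ι := .sigma _
  obtain ⟨s, hs⟩ := hι.exists_desc fun n ↦ y n.down ≫ ι ⟨n.down + 1⟩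
  -- The telescope of the sequence `Y`.
  obtain ⟨X, p, δ, hT⟩ := distinguished_cocone_triangle (𝟙 _ - s)
  have hX : P X := P.ext_of_isTriangulatedClosed₃ _ hT
    (hι.prop P fun n ↦ hY _) (hι.prop P fun n ↦ hY _)
  obtain ⟨e', he'⟩ := (hι.map Φ).exists_desc fun n ↦ e n.down
  obtain ⟨ε, hε⟩ := DistTriang.yoneda₂ (DistTriang.map_functor hT Φ) e'
    ((hι.map Φ).hom_ext fun n ↦ by
      rw [← Category.assoc, ← Φ.map_comp, Preadditive.comp_sub, Category.comp_id (ι n), hs,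
        Φ.map_sub, Preadditive.sub_comp, Φ.map_comp, Category.assoc, he' ⟨n.down + 1⟩, he, he',
        sub_self, comp_zero])
  have hεn : ∀ n, Φ.map (ι ⟨n⟩ ≫ p) ≫ ε = e n := fun n ↦ by
    rw [Φ.map_comp, Category.assoc, ← hε, he']
  have hp : ∀ n, y n ≫ ι ⟨n + 1⟩ ≫ p = ι ⟨n⟩ ≫ p := fun n ↦ by
    have h1 : ι ⟨n⟩ ≫ (𝟙 _ - s) ≫ p = 0 := by rw [DistTriang.comp₁₂ hT, comp_zero]
    rw [Preadditive.sub_comp, Category.id_comp, Preadditive.comp_sub, ← Category.assoc _ s p,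
      hs, sub_eq_zero] at h1
    rw [h1, Category.assoc]
  refine ⟨X, ε, hX, fun i ↦ ⟨?_, fun h ↦ ?_⟩⟩
  · have push : ∀ n m, n ≤ m → ∀ g : G i ⟶ Y n, ∃ g' : G i ⟶ Y m,
        g ≫ ι ⟨n⟩ ≫ p = g' ≫ ι ⟨m⟩ ≫ p := by
      intro n m hnm g
      induction m, hnm using Nat.le_induction with
      | base => exact ⟨g, rfl⟩
      | succ m _ ih =>
        obtain ⟨g', hg'⟩ := ih
        exact ⟨g' ≫ y _, by rw [hg', Category.assoc, hp]⟩
    suffices ∀ f : G i ⟶ X, Φ.map f ≫ ε = 0 → f = 0 by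
      intro f g hfg
      rw [← sub_eq_zero]
      exact this _ (by
        rw [Φ.map_sub, Preadditive.sub_comp, sub_eq_zero]
        exact hfg)
    intro f hf
    -- `f ≫ δ` is fixed by the shifted operator, hence zero. So `f` lifts to the coproduct, by
    -- compactness it comes from a single stage `Y N`, and it dies in `Y (N + 1)`.
    have hfδ : f ≫ δ = 0 := by
      refine eq_zero_of_comp_shift_eq (hG i) (fun n ↦ (y n)⟦(1 : ℤ)⟧')
        (hι.map (shiftFunctor K (1 : ℤ))) (s⟦(1 : ℤ)⟧') (fun n ↦ ?_) _ ?_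
      · rw [← Functor.map_comp, hs, Functor.map_comp]
      · have h0 := DistTriang.comp₃₁ hT
        rw [Functor.map_sub, CategoryTheory.Functor.map_id, Preadditive.comp_sub, Category.comp_id,
          sub_eq_zero] at h0
        rw [Category.assoc, ← h0]
    obtain ⟨g, hg⟩ := DistTriang.coyoneda₃ hT f hfδ
    have hfin : ∃ N, ∃ g' : G i ⟶ Y N, f = g' ≫ ι ⟨N⟩ ≫ p := by
      obtain ⟨S, a, ha⟩ := (compactObjects_iff _).1 (hG i) _ _ _ ι hι g
      rw [hg, ha, Preadditive.sum_comp]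
      clear ha
      classical
      induction S using Finset.induction_on with
      | empty => exact ⟨0, 0, by simp⟩
      | insert j S hj ih =>
        obtain ⟨N, g', hg'⟩ := ih
        obtain ⟨g₁, hg₁⟩ := push j.down _ (le_max_left _ N) (a j)
        obtain ⟨g₂, hg₂⟩ := push N _ (le_max_right j.down _) g'
        refine ⟨_, g₁ + g₂, ?_⟩
        rw [Finset.sum_insert hj, hg', Preadditive.add_comp, ← hg₁, ← hg₂, Category.assoc]
    obtain ⟨N, g', rfl⟩ := hfin
    have h0 : Φ.map g' ≫ e N = 0 := by rw [← hεn, ← Category.assoc, ← Φ.map_comp, hf]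
    rw [← hp, ← Category.assoc, hy N i g' h0, zero_comp]
  · refine ⟨ι₀ ⟨i, equivShrink _ h⟩ ≫ ι ⟨0⟩ ≫ p, ?_⟩
    dsimp only
    rw [Φ.map_comp, Category.assoc, hεn]
    exact (he₀ ⟨i, equivShrink _ h⟩).trans (by simp)

end Telescope

/-! ### Compact generation -/

section Generation

variable {K : Type u₁} [Category.{v₁} K] [Preadditive K] [HasZeroObject K] [HasShift K ℤ]
  [∀ n : ℤ, (shiftFunctor K n).Additive] [Pretriangulated K] [HasCoproducts.{w} K]

/-- A family of compact objects, closed under shifts, which detects zero objects. -/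
structure IsCompactlyGenerating {I : Type w} (G : I → K) : Prop where
  compact : ∀ i, compactObjects.{w} K (G i)
  shift : ∀ i (n : ℤ), ∃ j, Nonempty (G i⟦n⟧ ≅ G j)
  isZero : ∀ M : K, (∀ i (f : G i ⟶ M), f = 0) → IsZero M

variable [LocallySmall.{w} K] {I : Type w} {G : I → K}

/-- A localizing subcategory containing a set of compact generators is everything. -/
theorem IsCompactlyGenerating.prop (hG : IsCompactlyGenerating G) (P : ObjectProperty K)
    [P.IsTriangulated] [∀ J : Type w, P.IsClosedUnderColimitsOfShape (Discrete J)]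
    (hP : ∀ i, P (G i)) (X : K) : P X := by
  have := isClosedUnderIsomorphisms_of_coproducts.{w} P
  -- The cone of `ε` receives no nonzero map from any `G i`, so `ε` is invertible.
  obtain ⟨Y, ε, hY, hε⟩ := exists_cellular_approximation P (𝟭 K) X hG.compact hP
  dsimp at ε hε
  have hε' : ∀ i (f : G i ⟶ Y⟦(1 : ℤ)⟧), f ≫ ε⟦(1 : ℤ)⟧' = 0 → f = 0 := by
    intro i f hf
    obtain ⟨j, ⟨φ⟩⟩ := hG.shift i (-1)
    have adj : shiftFunctor K (-1 : ℤ) ⊣ shiftFunctor K (1 : ℤ) :=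
      (shiftEquiv K (1 : ℤ)).symm.toAdjunction
    obtain ⟨f', rfl⟩ := (adj.homEquiv _ _).surjective f
    rw [← adj.homEquiv_naturality_right] at hf
    have h0 : ∀ Z, adj.homEquiv (G i) Z 0 = 0 := fun Z ↦ by simp [Adjunction.homEquiv_unit]
    have hf' : f' ≫ ε = 0 := (adj.homEquiv _ _).injective (hf.trans (h0 _).symm)
    have : φ.inv ≫ f' = 0 := (hε j).1 (by simp [hf'])
    rw [← φ.hom_inv_id_assoc f', this, comp_zero, h0]
  obtain ⟨Z, g, h, hT⟩ := distinguished_cocone_triangle ε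
  have hZ : IsZero Z := hG.isZero _ fun i f ↦ by
    have hfh : f ≫ h = 0 := hε' i _ (by rw [Category.assoc, DistTriang.comp₃₁ hT, comp_zero])
    obtain ⟨a, ha⟩ := DistTriang.coyoneda₃ hT f hfh
    obtain ⟨b, hb⟩ := (hε i).2 a
    dsimp at hb
    rw [ha, ← hb, Category.assoc, DistTriang.comp₁₂ hT, comp_zero]
  have : IsIso ε := (Triangle.isZero₃_iff_isIso₁ _ hT).1 hZ
  exact P.prop_of_iso (asIso ε) hY

/-- A property of objects which holds for compact generators holds everywhere if it is
closed under coproducts and satisfies the two out of three property after allowing for shifts. -/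
theorem IsCompactlyGenerating.prop_of_cone (hG : IsCompactlyGenerating G) (B : ObjectProperty K)
    [∀ J : Type w, B.IsClosedUnderColimitsOfShape (Discrete J)]
    (hB : ∀ {X Y Z : K} {f : X ⟶ Y} {g : Y ⟶ Z} {h : Z ⟶ X⟦(1 : ℤ)⟧},
      Triangle.mk f g h ∈ distTriang K → B X → B Y → B (X⟦(1 : ℤ)⟧) → B (Y⟦(1 : ℤ)⟧) → B Z)
    (hP : ∀ i, B (G i)) (X : K) : B X := by
  have := isClosedUnderIsomorphisms_of_coproducts.{w} B
  -- Asking for `B` on all shifts at once gives a localizing subcategory.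
  let P : ObjectProperty K := fun V ↦ ∀ n : ℤ, B (V⟦n⟧)
  have : ∀ J : Type w, P.IsClosedUnderColimitsOfShape (Discrete J) := fun J ↦
    isClosedUnderColimitsOfShape_of_isCoproduct P J fun M X ι hι hM n ↦
      (hι.map (shiftFunctor K n)).prop B fun j ↦ hM j n
  have := isClosedUnderIsomorphisms_of_coproducts.{w} P
  have : P.IsStableUnderShift ℤ :=
    { isStableUnderShiftBy m := ⟨fun V hV n ↦
        B.prop_of_iso ((shiftFunctorAdd K m n).app V) (hV (m + n))⟩ }
  have : P.IsTriangulatedClosed₃ := .mk' fun T hT h₁ h₂ n ↦ by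
    refine hB (Triangle.shift_distinguished T hT n) (h₁ n) (h₂ n) ?_ ?_
    · exact B.prop_of_iso ((shiftFunctorAdd K n 1).app _) (h₁ (n + 1))
    · exact B.prop_of_iso ((shiftFunctorAdd K n 1).app _) (h₂ (n + 1))
  have : P.IsTriangulatedClosed₂ := .of_isTriangulatedClosed₃
  have : P.IsTriangulated :=
    { exists_zero := ⟨0, isZero_zero K, by
        refine IsCoproduct.prop (J := PEmpty.{w + 1}) (M := fun j ↦ j.elim) (ι := fun j ↦ j.elim)
          (fun Y f ↦ ⟨0, fun j ↦ j.elim, fun g _ ↦ (isZero_zero K).eq_of_src _ _⟩) P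
          fun j ↦ j.elim⟩ }
  have hX : P X := hG.prop P (fun i n ↦ by
    obtain ⟨j, ⟨e⟩⟩ := hG.shift i n
    exact B.prop_of_iso e.symm (hP j)) X
  exact B.prop_of_iso ((shiftFunctorZero K ℤ).app X) (hX 0)

variable {D : Type u₂} [Category.{v₂} D] [Preadditive D] [HasZeroObject D] [HasShift D ℤ]
  [∀ n : ℤ, (shiftFunctor D n).Additive] [Pretriangulated D]
  (Φ : K ⥤ D) [Φ.CommShift ℤ] [Φ.IsTriangulated]
  [∀ J : Type w, PreservesColimitsOfShape (Discrete J) Φ]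

/-- Dévissage in the source: Hom(V, X) and Hom(Φ V, W) are cohomological in `V` and turn coproducts
into products, so the five lemma applies. -/
theorem IsCompactlyGenerating.bijective_map_comp (hG : IsCompactlyGenerating G)
    {X : K} {W : D} (ε : Φ.obj X ⟶ W)
    (h : ∀ i, Function.Bijective fun f : G i ⟶ X ↦ Φ.map f ≫ ε) (V : K) :
    Function.Bijective fun f : V ⟶ X ↦ Φ.map f ≫ ε := by
  let B : ObjectProperty K := fun V ↦ Function.Bijective fun f : V ⟶ X ↦ Φ.map f ≫ ε
  have : ∀ J : Type w, B.IsClosedUnderColimitsOfShape (Discrete J) := fun J ↦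
    isClosedUnderColimitsOfShape_of_isCoproduct B J fun M X' ι hι hM ↦ by
      refine ⟨fun f g hfg ↦ hι.hom_ext fun j ↦ (hM j).1 ?_, fun c ↦ ?_⟩
      · have := congrArg (fun a ↦ Φ.map (ι j) ≫ a) hfg
        simpa using this
      · choose a ha using fun j ↦ (hM j).2 (Φ.map (ι j) ≫ c)
        obtain ⟨b, hb⟩ := hι.exists_desc a
        refine ⟨b, (hι.map Φ).hom_ext fun j ↦ ?_⟩
        rw [← ha, ← hb]
        simp
  refine hG.prop_of_cone B (fun {V₁ V₂ V₃ f g h} hT h₁ h₂ h₁' h₂' ↦ ⟨?_, fun c ↦ ?_⟩) h V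
  · suffices ∀ a : V₃ ⟶ X, Φ.map a ≫ ε = 0 → a = 0 by
      intro f g hfg
      rw [← sub_eq_zero]
      exact this _ (by
        rw [Φ.map_sub, Preadditive.sub_comp, sub_eq_zero]
        exact hfg)
    intro a ha
    have hga : g ≫ a = 0 := h₂.1 (by simp [ha])
    obtain ⟨b, rfl⟩ := DistTriang.yoneda₃ hT a hga
    obtain ⟨c, hc⟩ := DistTriang.map_yoneda₁ Φ hT (Φ.map b ≫ ε) (by simpa using ha)
    obtain ⟨c', rfl⟩ := h₂'.2 c
    have hb : b = f⟦(1 : ℤ)⟧' ≫ c' := h₁'.1 (by simpa using hc)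
    rw [hb, ← Category.assoc, DistTriang.comp₃₁ hT, zero_comp]
  · obtain ⟨b, hb⟩ := h₂.2 (Φ.map g ≫ c)
    dsimp only at hb
    have hfb : f ≫ b = 0 := h₁.1 (by
      simp [hb, ← Functor.map_comp_assoc, DistTriang.comp₁₂ hT])
    obtain ⟨a, rfl⟩ := DistTriang.yoneda₂ hT b hfb
    obtain ⟨d, hd⟩ := DistTriang.map_yoneda₃ Φ hT (c - Φ.map a ≫ ε) (by
      rw [Preadditive.comp_sub, ← hb]; simp)
    obtain ⟨d', rfl⟩ := h₁'.2 d
    refine ⟨a + h ≫ d', ?_⟩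
    dsimp only at hd ⊢
    rw [Φ.map_add, Preadditive.add_comp, Φ.map_comp, Category.assoc, ← hd, add_sub_cancel]

/-- Dévissage in the target: Hom(A, Φ W) and Hom(N, W) are homological in `W`, and they commute with
coproducts because `A` and `N` are compact. -/
theorem IsCompactlyGenerating.bijective_natural (hG : IsCompactlyGenerating G)
    [HasCoproducts.{w} D] {A : D} {N : K} (hA : compactObjects.{w} D A)
    (hN : compactObjects.{w} K N) (θ : ∀ W : K, (A ⟶ Φ.obj W) →+ (N ⟶ W))
    (hθ : ∀ {W W' : K} (f : A ⟶ Φ.obj W) (g : W ⟶ W'), θ W' (f ≫ Φ.map g) = θ W f ≫ g)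
    (h : ∀ i, Function.Bijective (θ (G i))) (W : K) : Function.Bijective (θ W) := by
  let B : ObjectProperty K := fun W ↦ Function.Bijective (θ W)
  have : ∀ J : Type w, B.IsClosedUnderColimitsOfShape (Discrete J) := fun J ↦
    isClosedUnderColimitsOfShape_of_isCoproduct B J fun M X ι hι hM ↦ by
      classical
      refine ⟨(injective_iff_map_eq_zero _).2 fun f hf ↦ ?_, fun c ↦ ?_⟩
      · obtain ⟨s, g, rfl⟩ := (compactObjects_iff _).1 hA _ _ _ _ (hι.map Φ) f
        -- The projections of the coproduct onto its summands.
        choose π hπ using fun j : J ↦ hι.exists_desc fun i ↦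
          if h : i = j then eqToHom (by rw [h]) else (0 : M i ⟶ M j)
        have hg : ∀ j ∈ s, g j = 0 := fun j hj ↦ (injective_iff_map_eq_zero _).1 (hM j).1 _ (by
          have h1 := congrArg (fun a ↦ a ≫ π j) hf
          rw [← hθ, Preadditive.sum_comp, Finset.sum_eq_single j, zero_comp] at h1
          · simpa [← Functor.map_comp, hπ] using h1
          · intro i _ hi
            simp [← Functor.map_comp, hπ, hi]
          · exact fun h ↦ (h hj).elim)
        exact Finset.sum_eq_zero fun j hj ↦ by rw [hg j hj, zero_comp]
      · obtain ⟨s, g, rfl⟩ := (compactObjects_iff _).1 hN _ _ _ _ hι c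
        choose a ha using fun j ↦ (hM j).2 (g j)
        exact ⟨∑ j ∈ s, a j ≫ Φ.map (ι j), by simp [hθ, ha]⟩
  refine hG.prop_of_cone B (fun {V₁ V₂ V₃ f g h} hT h₁ h₂ h₁' h₂' ↦
    ⟨(injective_iff_map_eq_zero _).2 fun a ha ↦ ?_, fun c ↦ ?_⟩) h W
  · have hah : a ≫ Φ.map h = 0 := h₁'.1 (by rw [hθ, ha, zero_comp, map_zero])
    obtain ⟨b, rfl⟩ := DistTriang.map_coyoneda₃ Φ hT a hah
    obtain ⟨c, hc⟩ := DistTriang.coyoneda₂ hT (θ _ b) (by rw [← hθ, ha])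
    obtain ⟨c', rfl⟩ := h₁.2 c
    have hb : b = c' ≫ Φ.map f := h₂.1 (by rw [hc, hθ])
    rw [hb, Category.assoc, ← Φ.map_comp, DistTriang.comp₁₂ hT, Φ.map_zero, comp_zero]
  · obtain ⟨d, hd⟩ := h₁'.2 (c ≫ h)
    have hdf : d ≫ Φ.map (f⟦(1 : ℤ)⟧') = 0 := h₂'.1 (by
      rw [hθ, hd, Category.assoc, DistTriang.comp₃₁ hT, comp_zero, map_zero])
    obtain ⟨e, rfl⟩ := DistTriang.map_coyoneda₁ Φ hT d hdf
    obtain ⟨k, hk⟩ := DistTriang.coyoneda₃ hT (c - θ _ e) (by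
      rw [Preadditive.sub_comp, ← hθ, hd, sub_self])
    obtain ⟨k', rfl⟩ := h₂.2 k
    exact ⟨e + k' ≫ Φ.map g, by rw [map_add, hθ, ← hk, add_sub_cancel]⟩

end Generation

/-! ### Compact objects are dualizable -/

section Rigid

section Pairing

variable {K : Type u₁} [Category.{v₁} K] [MonoidalCategory K] {Z H : K} (ev : Z ⊗ H ⟶ 𝟙_ K)

/-- Maps `V ⟶ H ⊗ W` induce maps `Z ⊗ V ⟶ W` by contraction with `ev`. -/
def contract (W : K) : Z ⊗ (H ⊗ W) ⟶ W := (α_ Z H W).inv ≫ ev ▷ W ≫ (λ_ W).hom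

lemma contract_naturality {W W' : K} (g : W ⟶ W') :
    Z ◁ H ◁ g ≫ contract ev W' = contract ev W ≫ g := by
  rw [contract, contract, associator_inv_naturality_right_assoc, whisker_exchange_assoc,
    leftUnitor_naturality]
  simp only [Category.assoc]

/-- For dualizable `W`, duality moves `W` to the source and reduces contraction to composition with
`ev`. -/
lemma whiskerLeft_tensorRightHomEquiv_comp_contract {V D W : K} [ExactPairing D W]
    (φ : V ⊗ D ⟶ H) :
    Z ◁ (tensorRightHomEquiv V D W H φ) ≫ contract ev W =
      tensorRightHomEquiv (Z ⊗ V) D W (𝟙_ K) ((α_ Z V D).hom ≫ Z ◁ φ ≫ ev) ≫ (λ_ W).hom := by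
  simp [contract, tensorRightHomEquiv]

/-- If contraction with `ev` always is bijective, then `ev` is the evaluation of a duality. -/
lemma nonempty_exactPairing_of_bijective_contract
    (h : ∀ V W : K, Function.Bijective fun f : V ⟶ H ⊗ W ↦ Z ◁ f ≫ contract ev W) :
    Nonempty (ExactPairing H Z) := by
  -- The coevaluation is the preimage of the identity of `Z`, up to the unitor. This is one triangle
  -- identity; the other follows from injectivity of contraction with `W = 𝟙_ K`.
  obtain ⟨c, hc⟩ := (h (𝟙_ K) Z).2 (ρ_ Z).hom
  have hc' : Z ◁ c ≫ (α_ Z H Z).inv ≫ ev ▷ Z = (ρ_ Z).hom ≫ (λ_ Z).inv := by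
    rw [← hc]; simp [contract]
  refine ⟨⟨c, ev, hc', ?_⟩⟩
  apply (h _ (𝟙_ K)).1
  have key : Z ◁ c ▷ H ≫ Z ◁ (α_ H Z H).hom ≫ contract ev (Z ⊗ H) =
      (α_ Z (𝟙_ K) H).inv ≫ (Z ◁ c ≫ (α_ Z H Z).inv ≫ ev ▷ Z) ▷ H ≫ (λ_ Z).hom ▷ H := by
    simp only [contract]
    monoidal
  simp only [MonoidalCategory.whiskerLeft_comp, Category.assoc, contract_naturality]
  rw [reassoc_of% key, hc', contract]
  monoidal

end Pairing

variable {K : Type u₁} [Category.{v₁} K] [Preadditive K] [HasZeroObject K] [HasShift K ℤ]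
  [∀ n : ℤ, (shiftFunctor K n).Additive] [Pretriangulated K] [MonoidalCategory K]
  [IsTensorTriangulated K]

instance (X : K) : (tensorLeft X).Additive := by
  obtain ⟨_, _⟩ := IsTensorTriangulated.exact_left X
  infer_instance

instance (X : K) : (tensorRight X).Additive := by
  obtain ⟨_, _⟩ := IsTensorTriangulated.exact_right X
  infer_instance

variable [HasCoproducts.{w} K]

/-- Tensoring with `X` is left adjoint to tensoring with `D`, which preserves coproducts. -/
lemma compactObjects_tensor_of_dual' {X Y D : K} [ExactPairing X D]
    [∀ (X : K) (J : Type w), PreservesColimitsOfShape (Discrete J) (tensorRight X)]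
    (hY : compactObjects.{w} K Y) : compactObjects.{w} K (Y ⊗ X) :=
  compactObjects_obj_of_adjunction (tensorRightAdjunction X D) (fun _ ↦ inferInstance) hY

variable
  [∀ (X : K) (J : Type w), PreservesColimitsOfShape (Discrete J) (tensorLeft X)]

lemma compactObjects_tensor_of_dual {X Y D : K} [ExactPairing D X]
    (hY : compactObjects.{w} K Y) : compactObjects.{w} K (X ⊗ Y) :=
  compactObjects_obj_of_adjunction (tensorLeftAdjunction D X) (fun _ ↦ inferInstance) hY

lemma compactObjects_of_dual (h1 : compactObjects.{w} K (𝟙_ K)) {X D : K} [ExactPairing D X] :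
    compactObjects.{w} K X :=
  compactObjects_of_iso (ρ_ X) (compactObjects_tensor_of_dual (D := D) h1)

variable [LocallySmall.{w} K]
  [∀ (X : K) (J : Type w), PreservesColimitsOfShape (Discrete J) (tensorRight X)]
  {I : Type w} {G : I → K}

/-- If the compact generators have duals, then every compact object has a dual. -/
theorem IsCompactlyGenerating.exists_dual [BraidedCategory K] (hG : IsCompactlyGenerating G)
    (hdual : ∀ i, ∃ D, Nonempty (ExactPairing D (G i))) {Z : K} (hZ : compactObjects.{w} K Z) :
    ∃ H, Nonempty (ExactPairing H Z) := by
  obtain ⟨_, _⟩ := IsTensorTriangulated.exact_left Z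
  have : (⊤ : ObjectProperty K).IsTriangulated :=
    { exists_zero := ⟨0, isZero_zero K, trivial⟩
      isStableUnderShiftBy _ := ⟨fun _ _ ↦ trivial⟩
      toIsTriangulatedClosed₂ := .mk' fun _ _ _ _ ↦ trivial }
  -- `H` represents `V ↦ (Z ⊗ V ⟶ 𝟙_ K)`, first on generators and then on all `V`.
  obtain ⟨H, ev, -, hev⟩ := exists_cellular_approximation (⊤ : ObjectProperty K)
    (tensorLeft Z) (𝟙_ K) hG.compact fun _ ↦ trivial
  replace hev := hG.bijective_map_comp (tensorLeft Z) ev hev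
  refine ⟨H, nonempty_exactPairing_of_bijective_contract ev fun V W ↦ ?_⟩
  -- Reduce `V` to `G i` for fixed `W`. Then `G i` and `Z ⊗ G i` are compact, so `W` reduces to `G
  -- j`, whose dual reduces the claim to `hev`.
  refine hG.bijective_map_comp (tensorLeft Z) (contract ev W) (fun i ↦ ?_) V
  obtain ⟨_, _⟩ := IsTensorTriangulated.exact_left H
  obtain ⟨Di, ⟨_⟩⟩ := hdual i
  let := BraidedCategory.exactPairing_swap Di (G i)
  refine hG.bijective_natural (tensorLeft H) (hG.compact i)
    (compactObjects_tensor_of_dual' (D := Di) hZ)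
    (fun W ↦ AddMonoidHom.mk' (fun f : G i ⟶ H ⊗ W ↦ Z ◁ f ≫ contract ev W) fun f g ↦ ?_)
    (fun f g ↦ ?_) (fun j ↦ ?_) W
  · exact (congrArg (· ≫ contract ev W) ((tensorLeft Z).map_add (f := f) (g := g))).trans
      (Preadditive.add_comp _ _ _ _ _ _)
  · simp [contract_naturality]
  · obtain ⟨Dj, ⟨_⟩⟩ := hdual j
    let e := tensorRightHomEquiv (G i) Dj (G j) H
    have h : (fun f : G i ⟶ H ⊗ G j ↦ Z ◁ f ≫ contract ev (G j)) ∘ e =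
        ((tensorRightHomEquiv (Z ⊗ G i) Dj (G j) (𝟙_ K)).trans
          (λ_ (G j)).homToEquiv) ∘
        ((α_ Z (G i) Dj).homFromEquiv).symm ∘ fun φ : G i ⊗ Dj ⟶ H ↦ Z ◁ φ ≫ ev := by
      funext φ
      simp [e, whiskerLeft_tensorRightHomEquiv_comp_contract]
    refine (Function.Bijective.of_comp_iff _ e.bijective).1 ?_
    refine h ▸ ?_
    exact (Equiv.bijective _).comp ((Equiv.bijective _).comp (hev _))

/-- A tensor triangulated category with coproducts preserved by the tensor product, which is
generated by a set of compact and dualizable objects, and whose unit is compact, is a big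
tt-category. -/
theorem IsCompactlyGenerating.isBigTTCategory [IsTriangulated K] [SymmetricCategory K]
    (hG : IsCompactlyGenerating G) (hdual : ∀ i, ∃ D, Nonempty (ExactPairing D (G i)))
    (h1 : compactObjects.{w} K (𝟙_ K)) : IsBigTTCategory.{w} K where
  locallySmall := inferInstance
  hasCoproducts := inferInstance
  tensorLeft_preserves := inferInstance
  tensorRight_preserves := inferInstance
  compactlyGenerated := ⟨I, G, hG.compact, fun M ↦ ⟨fun hM i n f ↦
    ((shiftFunctor K n).map_isZero hM).eq_of_tgt _ _, fun h ↦ hG.isZero M fun i f ↦ by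
      have := h i 0 (f ≫ ((shiftFunctorZero K ℤ).app M).inv)
      rwa [← cancel_mono ((shiftFunctorZero K ℤ).app M).inv, zero_comp]⟩⟩
  compact_isMonoidal :=
    { prop_unit := h1
      prop_tensor X Y hX hY := by
        obtain ⟨H, ⟨_⟩⟩ := hG.exists_dual hdual hX
        exact compactObjects_tensor_of_dual (D := H) hY }
  compact_rigid c hc := by
    obtain ⟨H, ⟨_⟩⟩ := hG.exists_dual hdual hc
    let := BraidedCategory.exactPairing_swap H c
    exact ⟨H, compactObjects_of_dual (D := c) h1, ⟨inferInstance⟩⟩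

end Rigid

/-! ### Smashing localizations -/

namespace IsCoproduct

variable {K : Type u₁} [Category.{v₁} K] {D : Type u₂} [Category.{v₂} D] {J : Type w}

lemma of_iso {M M' : J → K} {X X' : K} {ι : ∀ j, M j ⟶ X} {ι' : ∀ j, M' j ⟶ X'}
    (h : IsCoproduct ι) (e : ∀ j, M j ≅ M' j) (φ : X ≅ X')
    (w : ∀ j, ι j ≫ φ.hom = (e j).hom ≫ ι' j) : IsCoproduct ι' := by
  intro Y f
  obtain ⟨g, hg⟩ := h.exists_desc fun j ↦ (e j).hom ≫ f j
  have w' : ∀ j, ι' j = (e j).inv ≫ ι j ≫ φ.hom := fun j ↦ by simp [w]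
  refine ⟨φ.inv ≫ g, fun j ↦ by simp [w', hg], fun g' hg' ↦ ?_⟩
  rw [Iso.eq_inv_comp]
  refine h.hom_ext fun j ↦ ?_
  rw [hg, ← Category.assoc, w, Category.assoc, hg']

lemma isColimit_cocone {F : Discrete J ⥤ K} {c : Cocone F}
    (h : IsCoproduct fun j : J ↦ c.ι.app ⟨j⟩) : Nonempty (IsColimit c) :=
  ⟨{ desc s := (h.exists_desc fun j ↦ s.ι.app ⟨j⟩).choose
     fac s j := (h.exists_desc fun j ↦ s.ι.app ⟨j⟩).choose_spec j.as
     uniq s _ hm := h.hom_ext fun j ↦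
      (hm ⟨j⟩).trans ((h.exists_desc fun j ↦ s.ι.app ⟨j⟩).choose_spec j).symm }⟩

lemma hasCoproduct {M : J → K} {X : K} {ι : ∀ j, M j ⟶ X} (h : IsCoproduct ι) : HasCoproduct M :=
  ⟨⟨⟨_, h.isColimit.some⟩⟩⟩

/-- The comparison isomorphism between two coproducts of isomorphic families. -/
lemma exists_iso {M M' : J → K} {X X' : K} {ι : ∀ j, M j ⟶ X} {ι' : ∀ j, M' j ⟶ X'}
    (h : IsCoproduct ι) (h' : IsCoproduct ι') (e : ∀ j, M j ≅ M' j) :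
    ∃ φ : X ≅ X', ∀ j, ι j ≫ φ.hom = (e j).hom ≫ ι' j := by
  obtain ⟨f, hf⟩ := h.exists_desc fun j ↦ (e j).hom ≫ ι' j
  obtain ⟨g, hg⟩ := h'.exists_desc fun j ↦ (e j).inv ≫ ι j
  exact ⟨⟨f, g, h.hom_ext fun j ↦ by simp [reassoc_of% hf, hg],
    h'.hom_ext fun j ↦ by simp [reassoc_of% hg, hf]⟩, hf⟩

end IsCoproduct

lemma preservesCoproducts_of_isCoproduct {K : Type u₁} [Category.{v₁} K] {D : Type u₂}
    [Category.{v₂} D] {J : Type w} (F : K ⥤ D)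
    (h : ∀ (M : J → K) (X : K) (ι : ∀ j, M j ⟶ X), IsCoproduct ι →
      IsCoproduct fun j ↦ F.map (ι j)) :
    PreservesColimitsOfShape (Discrete J) F where
  preservesColimit :=
    { preserves hc := IsCoproduct.isColimit_cocone (h _ _ _ (.of_cofan hc)) }

namespace IdempotentAlgebra

variable {T : Type u} [Category.{v} T] [MonoidalCategory T]

/-- The map `X ⟶ A ⊗ X` induced by the unit of `A`. -/
def unitMap (A : IdempotentAlgebra T) (X : T) : X ⟶ A.obj ⊗ X := (λ_ X).inv ≫ A.η ▷ X

lemma unitMap_naturality (A : IdempotentAlgebra T) {X Y : T} (f : X ⟶ Y) :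
    f ≫ A.unitMap Y = A.unitMap X ≫ A.obj ◁ f := by
  simp [unitMap, ← whisker_exchange]

instance [SymmetricCategory T] (A : IdempotentAlgebra T) (X : T) : IsIso (A.unitMap (A.obj ⊗ X)) := by
  have := A.isIso
  have := (isIso_whiskerRight_iff A.obj A.η).2 A.isIso
  have h : A.η ▷ (A.obj ⊗ X) =
      (α_ _ _ _).inv ≫ (A.η ▷ A.obj) ▷ X ≫ (α_ _ _ _).hom := by simp
  rw [unitMap, h]
  infer_instance

end IdempotentAlgebra

section Conservative

variable {T : Type u} [Category.{v} T] [Preadditive T] [HasZeroObject T] [HasShift T ℤ]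
  [∀ n : ℤ, (shiftFunctor T n).Additive] [Pretriangulated T] [IsTriangulated T]
  {S : ObjectProperty T} [S.IsTriangulated]
  {K : Type u₂} [Category.{v₂} K] (L : T ⥤ K) [L.IsLocalization S.trW]

/-- The localization functor is conservative on local objects. -/
lemma isIso_of_isIso_map {X Y : T} (hX : S.rightOrthogonal X) (hY : S.rightOrthogonal Y)
    (f : X ⟶ Y) [IsIso (L.map f)] : IsIso f := by
  obtain ⟨g, hg⟩ := (hX.map_bijective_of_isTriangulated L Y).2 (inv (L.map f))
  refine ⟨g, (hX.map_bijective_of_isTriangulated L _).1 ?_,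
    (hY.map_bijective_of_isTriangulated L _).1 ?_⟩ <;> simp [hg]

end Conservative

section Exact

variable {T : Type u} [Category.{v} T] [Preadditive T] [HasZeroObject T] [HasShift T ℤ]
  [∀ n : ℤ, (shiftFunctor T n).Additive] [Pretriangulated T] [IsTriangulated T]
  {K : Type u₂} [Category.{v₂} K] [Preadditive K] [HasZeroObject K] [HasShift K ℤ]
  [∀ n : ℤ, (shiftFunctor K n).Additive] [Pretriangulated K]

/-- An endofunctor of the localization induced by an exact functor is exact. -/
lemma exists_commShift_isTriangulated_of_localization (S : ObjectProperty T) [S.IsTriangulated]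
    (L : T ⥤ K) [L.IsLocalization S.trW] [L.CommShift ℤ] [L.IsTriangulated]
    (G : T ⥤ T) (F : K ⥤ K) (φ : L ⋙ F ≅ G ⋙ L)
    (hG : ∃ _ : G.CommShift ℤ, G.IsTriangulated) :
    ∃ _ : F.CommShift ℤ, F.IsTriangulated := by
  obtain ⟨_, _⟩ := hG
  let : Localization.Lifting L S.trW (G ⋙ L) F := ⟨φ⟩
  let inst := Functor.commShiftOfLocalization L S.trW ℤ (G ⋙ L) F
  have := Localization.essSurj_mapArrow L S.trW
  exact ⟨inst, Functor.isTriangulated_of_precomp_iso (Localization.Lifting.iso L S.trW (G ⋙ L) F)⟩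

end Exact

/-- Followed by the invertible unit map of `A ⊗ X`, a map from `Y` in `S` factors through `A ⊗ Y =
0`. -/
lemma rightOrthogonal_tensor {T : Type u} [Category.{v} T] [Preadditive T] [MonoidalCategory T]
    [SymmetricCategory T] {S : ObjectProperty T} {A : IdempotentAlgebra T}
    (hS : S ≤ A.annihilator) (X : T) :
    S.rightOrthogonal (A.obj ⊗ X) := by
  intro Y f hY
  rw [← cancel_mono (A.unitMap (A.obj ⊗ X)), A.unitMap_naturality,
    (hS Y hY).eq_of_src (A.obj ◁ f) 0, comp_zero, zero_comp]

section Local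

variable {T : Type u} [Category.{v} T] [Preadditive T] [HasZeroObject T] [HasShift T ℤ]
  [∀ n : ℤ, (shiftFunctor T n).Additive] [Pretriangulated T]
  [MonoidalCategory T] [SymmetricCategory T]

variable {S : ObjectProperty T} {A : IdempotentAlgebra T}

variable [IsTensorTriangulated T] [S.IsTriangulated] [IsTensorIdeal S] [IsTriangulated T]

/-- The cone of `η` is a shift of an object of the ideal `S`. Together with `rightOrthogonal_tensor`
this makes `X ⟶ A ⊗ X` the localization of `X`. -/
lemma IdempotentAlgebra.Corresponds.trW_unitMap (hA : A.Corresponds S) (X : T) :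
    S.trW (A.unitMap X) := by
  obtain ⟨-, C, ε, δ, hC, hT⟩ := hA
  have h : S.trW A.η := ObjectProperty.trW.mk S (DistTriang.rotate hT) (S.le_shift _ _ hC)
  exact (S.trW.cancel_left_of_respectsIso _ _).2 (S.trW.whiskerRight_mem _ h X)

variable {K : Type u₂} [Category.{v₂} K] (L : T ⥤ K) [L.IsLocalization S.trW]

lemma isIso_map_unitMap (hA : A.Corresponds S) (X : T) : IsIso (L.map (A.unitMap X)) :=
  Localization.inverts L S.trW _ (hA.trW_unitMap X)

lemma isIso_unitMap (hA : A.Corresponds S) (hS : S ≤ A.annihilator) {X : T}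
    (hX : S.rightOrthogonal X) : IsIso (A.unitMap X) :=
  have := isIso_map_unitMap S.trW.Q hA X
  isIso_of_isIso_map S.trW.Q hX (rightOrthogonal_tensor hS X) _

lemma exists_local_preimage (hA : A.Corresponds S) (hS : S ≤ A.annihilator) (Y : K) :
    ∃ X : T, S.rightOrthogonal X ∧ Nonempty (L.obj X ≅ Y) := by
  have := Localization.essSurj L S.trW
  have := isIso_map_unitMap L hA (L.objPreimage Y)
  exact ⟨_, rightOrthogonal_tensor hS (L.objPreimage Y),
    ⟨(asIso (L.map (A.unitMap _))).symm ≪≫ L.objObjPreimageIso Y⟩⟩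

lemma locallySmall_of_isLocalization (L : T ⥤ K) [L.IsLocalization S.trW]
    [LocallySmall.{w} T] (hA : A.Corresponds S)
    (hS : S ≤ A.annihilator) : LocallySmall.{w} K where
  hom_small X Y := by
    obtain ⟨X', -, ⟨e⟩⟩ := exists_local_preimage L hA hS X
    obtain ⟨Y', hY', ⟨e'⟩⟩ := exists_local_preimage L hA hS Y
    refine small_of_surjective (f := fun f : X' ⟶ Y' ↦ e.inv ≫ L.map f ≫ e'.hom) fun g ↦ ?_
    obtain ⟨f, hf⟩ := (hY'.map_bijective_of_isTriangulated L X').2 (e.hom ≫ g ≫ e'.inv)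
    exact ⟨f, by simp [hf]⟩

/-- The universal property may be tested on images of local objects, where it is the one in `T`. -/
lemma IsCoproduct.map_localization (hA : A.Corresponds S) (hS : S ≤ A.annihilator) {J : Type w}
    {M : J → T} {X : T} {ι : ∀ j, M j ⟶ X} (hι : IsCoproduct ι) :
    IsCoproduct fun j ↦ L.map (ι j) := by
  intro Y f
  obtain ⟨Y', hY', ⟨e⟩⟩ := exists_local_preimage L hA hS Y
  have hL : ∀ X, Function.Bijective (L.map : (X ⟶ Y') → _) :=
    hY'.map_bijective_of_isTriangulated L
  choose f' hf' using fun j ↦ (hL _).2 (f j ≫ e.inv)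
  obtain ⟨g, hg⟩ := hι.exists_desc f'
  refine ⟨L.map g ≫ e.hom, fun j ↦ by simp [← Functor.map_comp_assoc, hg, hf'], fun k hk ↦ ?_⟩
  obtain ⟨k', hk'⟩ := (hL _).2 (k ≫ e.inv)
  have : k' = g := hι.hom_ext fun j ↦ (hL _).1 (by simp [hk', hg, hf', reassoc_of% (hk j)])
  rw [← this, hk']
  simp

lemma exists_coproduct_preimage [HasCoproducts.{w} T] (hA : A.Corresponds S)
    (hS : S ≤ A.annihilator) {J : Type w} (M : J → K) :
    ∃ (M' : J → T) (X : T) (ι : ∀ j, M' j ⟶ X) (e : ∀ j, L.obj (M' j) ≅ M j),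
      IsCoproduct ι ∧ IsCoproduct fun j ↦ (e j).inv ≫ L.map (ι j) := by
  choose M' _ e using fun j ↦ exists_local_preimage L hA hS (M j)
  refine ⟨M', ∐ M', Sigma.ι M', fun j ↦ (e j).some, .sigma _, ?_⟩
  exact ((IsCoproduct.sigma M').map_localization L hA hS).of_iso (fun j ↦ (e j).some) (Iso.refl _)
    (by simp)

lemma hasCoproducts_of_isLocalization (L : T ⥤ K) [L.IsLocalization S.trW]
    [HasCoproducts.{w} T] (hA : A.Corresponds S)
    (hS : S ≤ A.annihilator) : HasCoproducts.{w} K := fun J ↦ by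
  have : ∀ M : J → K, HasCoproduct M := fun M ↦ by
    obtain ⟨M', X, ι, e, -, h⟩ := exists_coproduct_preimage L hA hS M
    exact h.hasCoproduct
  exact { has_colimit F := hasColimit_of_iso Discrete.natIsoFunctor }

lemma preservesCoproducts_of_localization [HasCoproducts.{w} T] (hA : A.Corresponds S)
    (hS : S ≤ A.annihilator) {J : Type w} (G : T ⥤ T)
    [PreservesColimitsOfShape (Discrete J) G] (F : K ⥤ K) (φ : L ⋙ F ≅ G ⋙ L) :
    PreservesColimitsOfShape (Discrete J) F :=
  preservesCoproducts_of_isCoproduct F fun M X ι hι ↦ by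
    obtain ⟨M', X', ι', e, h', h⟩ := exists_coproduct_preimage L hA hS M
    obtain ⟨ψ, hψ⟩ := h.exists_iso hι fun j ↦ Iso.refl (M j)
    refine ((h'.map G).map_localization L hA hS).of_iso (fun j ↦ (φ.app _).symm ≪≫ F.mapIso (e j))
      ((φ.app _).symm ≪≫ F.mapIso ψ) fun j ↦ ?_
    have h1 : L.map (ι' j) ≫ ψ.hom = (e j).hom ≫ ι j := by simpa [Iso.inv_comp_eq] using hψ j
    have h2 := φ.inv.naturality (ι' j)
    dsimp at h2 ⊢
    rw [← Category.assoc, h2, Category.assoc, Category.assoc, ← F.map_comp, ← F.map_comp, h1]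

variable [Preadditive K] [HasZeroObject K] [HasShift K ℤ]
  [∀ n : ℤ, (shiftFunctor K n).Additive] [Pretriangulated K] [L.CommShift ℤ] [L.IsTriangulated]

/-- A map from `L t` to a coproduct comes from a map `t ⟶ A ⊗ X'`. Since `A ⊗ X'` is the coproduct
of the `A ⊗ M' j`, compactness of `t` applies. -/
lemma compactObjects_localization [HasCoproducts.{w} T] [HasCoproducts.{w} K]
    [∀ (X : T) (J : Type w), PreservesColimitsOfShape (Discrete J) (tensorLeft X)]
    (hA : A.Corresponds S) (hS : S ≤ A.annihilator)
    {t : T} (ht : compactObjects.{w} T t) : compactObjects.{w} K (L.obj t) := by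
  rw [compactObjects_iff] at ht ⊢
  intro J M X ι hι f
  have := isIso_map_unitMap L hA
  obtain ⟨M', X', ι', e, h', h⟩ := exists_coproduct_preimage L hA hS M
  obtain ⟨ψ, hψ⟩ := h.exists_iso hι fun j ↦ Iso.refl (M j)
  obtain ⟨f', hf'⟩ := ((rightOrthogonal_tensor hS X').map_bijective_of_isTriangulated L t).2
    (f ≫ ψ.inv ≫ L.map (A.unitMap X'))
  obtain ⟨s, g, rfl⟩ := ht J _ _ _ (h'.map (tensorLeft A.obj)) f'
  refine ⟨s, fun j ↦ L.map (g j) ≫ inv (L.map (A.unitMap (M' j))) ≫ (e j).hom, ?_⟩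
  have hf : f = (f ≫ ψ.inv ≫ L.map (A.unitMap X')) ≫ inv (L.map (A.unitMap X')) ≫ ψ.hom := by
    simp
  rw [hf, ← hf', L.map_sum, Preadditive.sum_comp]
  refine Finset.sum_congr rfl fun j _ ↦ ?_
  have h1 : L.map (ι' j) ≫ ψ.hom = (e j).hom ≫ ι j := by simpa [Iso.inv_comp_eq] using hψ j
  have h2 := congrArg L.map (A.unitMap_naturality (ι' j))
  rw [L.map_comp, L.map_comp] at h2
  have h3 : L.map (A.obj ◁ ι' j) ≫ inv (L.map (A.unitMap X')) ≫ ψ.hom =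
      inv (L.map (A.unitMap (M' j))) ≫ L.map (ι' j) ≫ ψ.hom := by
    rw [IsIso.eq_inv_comp, ← Category.assoc, ← h2]
    simp
  simp only [L.map_comp, Category.assoc]
  rw [← h1]
  exact congrArg (fun a ↦ L.map (g j) ≫ a) h3

lemma IsCompactlyGenerating.localization [HasCoproducts.{w} T] [HasCoproducts.{w} K]
    [∀ (X : T) (J : Type w), PreservesColimitsOfShape (Discrete J) (tensorLeft X)]
    (hA : A.Corresponds S) (hS : S ≤ A.annihilator) {I : Type w} {G : I → T}
    (hG : IsCompactlyGenerating G) : IsCompactlyGenerating fun i ↦ L.obj (G i) where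
  compact i := compactObjects_localization L hA hS (hG.compact i)
  shift i n := by
    obtain ⟨j, ⟨e⟩⟩ := hG.shift i n
    exact ⟨j, ⟨((L.commShiftIso n).app _).symm ≪≫ L.mapIso e⟩⟩
  isZero M hM := by
    obtain ⟨M', hM', ⟨e⟩⟩ := exists_local_preimage L hA hS M
    refine (L.map_isZero (hG.isZero M' fun i f ↦ ?_)).of_iso e.symm
    apply (hM'.map_bijective_of_isTriangulated L _).1
    have := hM i (L.map f ≫ e.hom)
    rw [← cancel_mono e.hom, this, L.map_zero, zero_comp]

end Local

/-! ### Tensor products and duality on a localization. -/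

section TensorLocalization

/-- The image of a duality under a strong monoidal functor. -/
@[reducible]
def exactPairingMap {C : Type u} [Category.{v} C] [MonoidalCategory C] {D : Type u₂}
    [Category.{v₂} D] [MonoidalCategory D] (F : C ⥤ D) [F.Monoidal] (X Y : C)
    [ExactPairing X Y] : ExactPairing (F.obj X) (F.obj Y) where
  coevaluation' := Functor.LaxMonoidal.ε F ≫ F.map (η_ X Y) ≫ Functor.OplaxMonoidal.δ F X Y
  evaluation' := Functor.LaxMonoidal.μ F Y X ≫ F.map (ε_ X Y) ≫ Functor.OplaxMonoidal.η F
  coevaluation_evaluation' := by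
    have h := congrArg F.map (ExactPairing.coevaluation_evaluation X Y)
    simp only [Functor.map_comp, Functor.Monoidal.map_whiskerLeft, Functor.Monoidal.map_whiskerRight,
      Functor.Monoidal.map_associator_inv, Functor.Monoidal.map_rightUnitor,
      Functor.Monoidal.map_leftUnitor_inv, Category.assoc, Functor.Monoidal.μ_δ_assoc] at h
    rw [cancel_epi] at h
    simp only [← Category.assoc, cancel_mono] at h
    simpa using congrArg (fun f ↦ F.obj Y ◁ Functor.LaxMonoidal.ε F ≫ f ≫
      Functor.OplaxMonoidal.η F ▷ F.obj Y) h
  evaluation_coevaluation' := by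
    have h := congrArg F.map (ExactPairing.evaluation_coevaluation X Y)
    simp only [Functor.map_comp, Functor.Monoidal.map_whiskerLeft, Functor.Monoidal.map_whiskerRight,
      Functor.Monoidal.map_associator, Functor.Monoidal.map_leftUnitor,
      Functor.Monoidal.map_rightUnitor_inv, Category.assoc, Functor.Monoidal.μ_δ_assoc] at h
    rw [cancel_epi] at h
    simp only [← Category.assoc, cancel_mono] at h
    simpa using congrArg (fun f ↦ Functor.LaxMonoidal.ε F ▷ F.obj X ≫ f ≫
      F.obj X ◁ Functor.OplaxMonoidal.η F) h

section

variable {T : Type u} [Category.{v} T] [MonoidalCategory T] {K : Type u₂} [Category.{v₂} K]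
  [MonoidalCategory K] (L : T ⥤ K) [L.EssSurj] [L.Monoidal]

/-- Exactness and preservation of coproducts by `tensorLeft X` are inherited from `T` through such a
lift. -/
lemma exists_localization_tensorLeft (X : K) :
    ∃ X' : T, Nonempty (L ⋙ tensorLeft X ≅ tensorLeft X' ⋙ L) :=
  ⟨_, ⟨Functor.isoWhiskerLeft L ((curriedTensor K).mapIso (L.objObjPreimageIso X).symm) ≪≫
    Functor.Monoidal.commTensorLeft L _⟩⟩

lemma exists_localization_tensorRight (X : K) :
    ∃ X' : T, Nonempty (L ⋙ tensorRight X ≅ tensorRight X' ⋙ L) :=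
  ⟨_, ⟨Functor.isoWhiskerLeft L
    ((curriedTensor K).flip.mapIso (L.objObjPreimageIso X).symm) ≪≫
      Functor.Monoidal.commTensorRight L _⟩⟩

end

variable {T : Type u} [Category.{v} T] [Preadditive T] [HasZeroObject T] [HasShift T ℤ]
  [∀ n : ℤ, (shiftFunctor T n).Additive] [Pretriangulated T]
  [MonoidalCategory T] [IsTriangulated T] [IsTensorTriangulated T]
  {K : Type u₂} [Category.{v₂} K] [Preadditive K] [HasZeroObject K] [HasShift K ℤ]
  [∀ n : ℤ, (shiftFunctor K n).Additive] [Pretriangulated K] [MonoidalCategory K]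

lemma isTensorTriangulated_of_localization (S : ObjectProperty T) [S.IsTriangulated]
    (L : T ⥤ K) [L.IsLocalization S.trW] [L.CommShift ℤ] [L.IsTriangulated] [L.Monoidal] :
    IsTensorTriangulated K := by
  have := Localization.essSurj L S.trW
  constructor
  · intro X
    obtain ⟨X', ⟨φ⟩⟩ := exists_localization_tensorLeft L X
    exact exists_commShift_isTriangulated_of_localization S L _ _ φ
      (IsTensorTriangulated.exact_left X')
  · intro X
    obtain ⟨X', ⟨φ⟩⟩ := exists_localization_tensorRight L X
    exact exists_commShift_isTriangulated_of_localization S L _ _ φ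
      (IsTensorTriangulated.exact_right X')

end TensorLocalization

section BigTT

variable {T : Type u} [Category.{v} T] [Preadditive T] [HasZeroObject T] [HasShift T ℤ]
  [∀ n : ℤ, (shiftFunctor T n).Additive] [Pretriangulated T]
  [MonoidalCategory T] [SymmetricCategory T]

variable (T) in
-- All shifts of the given generators are added to the family.
lemma exists_isCompactlyGenerating [IsBigTTCategory.{w} T] [HasCoproducts.{w} T] :
    ∃ (I : Type w) (G : I → T), IsCompactlyGenerating G := by
  obtain ⟨I, G, hG, h⟩ := IsBigTTCategory.compactlyGenerated.{w} (T := T)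
  refine ⟨I × ℤ, fun i ↦ G i.1⟦i.2⟧, fun i ↦ compactObjects_shift (hG i.1) i.2, fun i n ↦
    ⟨(i.1, i.2 + n), ⟨((shiftFunctorAdd T i.2 n).app (G i.1)).symm⟩⟩, fun M hM ↦ ?_⟩
  refine (h M).2 fun i n f ↦ ?_
  have adj : shiftFunctor T (-n) ⊣ shiftFunctor T n := (shiftEquiv T n).symm.toAdjunction
  apply (adj.homEquiv _ _).symm.injective
  rw [hM (i, -n) ((adj.homEquiv _ _).symm f), hM (i, -n) ((adj.homEquiv _ _).symm 0)]

/-- The localization of a big tt-category at a smashing ideal is a big tt-category. -/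
theorem isBigTTCategory_of_localization [IsBigTTCategory.{w} T]
    {S : ObjectProperty T} [S.IsTriangulated] [IsTensorIdeal S] {A : IdempotentAlgebra T}
    (hA : A.Corresponds S) (hS : S ≤ A.annihilator)
    {K : Type u₂} [Category.{v₂} K] [Preadditive K] [HasZeroObject K] [HasShift K ℤ]
    [∀ n : ℤ, (shiftFunctor K n).Additive] [Pretriangulated K] [MonoidalCategory K]
    [SymmetricCategory K]
    (L : T ⥤ K) [L.IsLocalization S.trW] [L.CommShift ℤ] [L.IsTriangulated] [L.Monoidal] :
    IsBigTTCategory.{w} K := by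
  have := Localization.essSurj L S.trW
  have := IsBigTTCategory.hasCoproducts.{w} (T := T)
  have := IsBigTTCategory.locallySmall.{w} (T := T)
  have := IsBigTTCategory.tensorLeft_preserves.{w} (T := T)
  have := IsBigTTCategory.tensorRight_preserves.{w} (T := T)
  have : IsTriangulated K := Triangulated.Localization.isTriangulated L S.trW
  have : IsTensorTriangulated K := isTensorTriangulated_of_localization S L
  have : HasCoproducts.{w} K := hasCoproducts_of_isLocalization L hA hS
  have : LocallySmall.{w} K := locallySmall_of_isLocalization L hA hS
  have (X : K) (J : Type w) : PreservesColimitsOfShape (Discrete J) (tensorLeft X) := by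
    obtain ⟨X', ⟨φ⟩⟩ := exists_localization_tensorLeft L X
    exact preservesCoproducts_of_localization L hA hS _ _ φ
  have (X : K) (J : Type w) : PreservesColimitsOfShape (Discrete J) (tensorRight X) := by
    obtain ⟨X', ⟨φ⟩⟩ := exists_localization_tensorRight L X
    exact preservesCoproducts_of_localization L hA hS _ _ φ
  obtain ⟨I, G, hG⟩ := exists_isCompactlyGenerating.{w} T
  refine (hG.localization L hA hS).isBigTTCategory (fun i ↦ ?_) ?_
  · obtain ⟨D, -, ⟨_⟩⟩ := IsBigTTCategory.compact_rigid (T := T) (G i) (hG.compact i)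
    let := BraidedCategory.exactPairing_swap (G i) D
    exact ⟨L.obj D, ⟨exactPairingMap L D (G i)⟩⟩
  · have := IsBigTTCategory.compact_isMonoidal.{w} (T := T)
    exact compactObjects_of_iso (Functor.Monoidal.εIso L).symm
      (compactObjects_localization L hA hS (ObjectProperty.prop_unit _))

end BigTT

/-- Hom(Y, X ⊗ c) = Hom(Y ⊗ d, X), and `Y ⊗ d` stays in the ideal. -/
lemma rightOrthogonal_tensor_of_dual {T : Type u} [Category.{v} T] [Preadditive T]
    [MonoidalCategory T] [SymmetricCategory T] {S : ObjectProperty T}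
    [S.IsClosedUnderIsomorphisms] [IsTensorIdeal S] {X : T} (hX : S.rightOrthogonal X) (c d : T) [ExactPairing d c] :
    S.rightOrthogonal (X ⊗ c) := by
  intro Y f hY
  have h : S (Y ⊗ d) := S.prop_of_iso (β_ d Y) (IsTensorIdeal.tensor_mem d Y hY)
  apply (tensorRightHomEquiv Y d c X).symm.injective
  rw [hX ((tensorRightHomEquiv Y d c X).symm f) h, hX ((tensorRightHomEquiv Y d c X).symm 0) h]

/-! ### Smashing ideals and annihilators. -/

section Smashing

variable {T : Type u} [Category.{v} T] [Preadditive T] [HasZeroObject T] [HasShift T ℤ]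
  [∀ n : ℤ, (shiftFunctor T n).Additive] [Pretriangulated T]
  [MonoidalCategory T] [SymmetricCategory T] [IsBigTTCategory.{w} T]

/-- A smashing ideal is annihilated by the corresponding idempotent algebra. -/
theorem IsSmashing.le_annihilator {S : ObjectProperty T} [S.IsTriangulated] [IsTensorIdeal S]
    (hS : IsSmashing.{w} S) {A : IdempotentAlgebra T} (hA : A.Corresponds S) :
    S ≤ A.annihilator := by
  have := IsBigTTCategory.hasCoproducts.{w} (T := T)
  have := IsBigTTCategory.tensorLeft_preserves.{w} (T := T)
  have := IsBigTTCategory.locallySmall.{w} (T := T)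
  have := hS.localizing
  have := hS.orthogonal
  have := isClosedUnderIsomorphisms_of_coproducts.{w} S
  obtain ⟨_, _⟩ := IsTensorTriangulated.exact_left A.obj
  obtain ⟨I, G, hG⟩ := exists_isCompactlyGenerating.{w} T
  have h (X : T) : S.rightOrthogonal (A.obj ⊗ X) := by
    -- This subcategory is closed under coproducts because `S` is smashing; rigidity puts the
    -- compact generators in it.
    refine hG.prop (S.rightOrthogonal.inverseImage (tensorLeft A.obj)) (fun i ↦ ?_) X
    obtain ⟨d, -, ⟨_⟩⟩ := IsBigTTCategory.compact_rigid (T := T) (G i) (hG.compact i)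
    let := BraidedCategory.exactPairing_swap (G i) d
    exact rightOrthogonal_tensor_of_dual hA.1 (G i) d
  intro Y hY
  -- `A ⊗ Y` lies in `S` and in its right orthogonal, so its identity vanishes.
  exact (IsZero.iff_id_eq_zero _).2 (h Y _ (IsTensorIdeal.tensor_mem _ _ hY))

/-- An idempotent algebra corresponds to the ideal of objects annihilated by it. -/
lemma IdempotentAlgebra.corresponds_annihilator (A : IdempotentAlgebra T) :
    A.Corresponds A.annihilator := by
  obtain ⟨_, _⟩ := IsTensorTriangulated.exact_left A.obj
  refine ⟨?_, ?_⟩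
  · have := A.isIso
    refine A.annihilator.rightOrthogonal.prop_of_iso ((asIso (A.obj ◁ A.η)).symm ≪≫ ρ_ _)
      (rightOrthogonal_tensor le_rfl _)
  · obtain ⟨C, ε, δ, h⟩ := distinguished_cocone_triangle₁ A.η
    refine ⟨C, ε, δ, ?_, h⟩
    exact Triangle.isZero₁_of_isIso₂ _ ((tensorLeft A.obj).map_distinguished _ h) A.isIso

end Smashing

/-! ### The order on idempotent algebras -/

namespace IdempotentAlgebra

variable {T : Type u} [Category.{v} T] [MonoidalCategory T]

lemma unitMap_unit (A : IdempotentAlgebra T) : A.unitMap (𝟙_ T) = A.η ≫ (ρ_ _).inv := by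
  rw [unitMap, MonoidalCategory.whiskerRight_id, unitors_inv_equal]
  simp

/-- If `B` is local with respect to `A`, then `A ≤ B`. -/
lemma le_of_isIso_unitMap {A B : IdempotentAlgebra T} [IsIso (A.unitMap B.obj)] : A ≤ B :=
  ⟨(ρ_ _).inv ≫ A.obj ◁ B.η ≫ inv (A.unitMap B.obj), by
    rw [← Category.assoc, ← unitMap_unit, ← Category.assoc, ← A.unitMap_naturality]
    simp⟩

variable [SymmetricCategory T]

lemma tensor_self_le (A : IdempotentAlgebra T) : A.tensor A ≤ A := by
  have : IsIso (A.obj ◁ A.η) := A.isIso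
  let φ : A.obj ⊗ A.obj ⟶ A.obj := inv (A.obj ◁ A.η) ≫ (ρ_ _).hom
  refine ⟨φ, ?_⟩
  simp [φ, tensor, MonoidalCategory.tensorHom_def, unitors_inv_equal]

lemma le_tensor_left (A B : IdempotentAlgebra T) : A ≤ A.tensor B :=
  ⟨(ρ_ _).inv ≫ A.obj ◁ B.η, by
    simp [tensor, MonoidalCategory.tensorHom_def, unitors_inv_equal]⟩

lemma le_tensor_right (A B : IdempotentAlgebra T) : B ≤ A.tensor B :=
  ⟨(λ_ _).inv ≫ A.η ▷ B.obj, by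
    simp [tensor, MonoidalCategory.tensorHom_def']⟩

end IdempotentAlgebra

lemma Idem.exists_mk {T : Type u} [Category.{v} T] [MonoidalCategory T] (x : Idem T) :
    ∃ A, Idem.mk A = x :=
  Quotient.exists_rep x

/-- If `A, B ≤ C`, then `A ⊗ B ≤ C ⊗ C ≤ C`, the last step being the multiplication of `C`. -/
lemma Idem.isLUB_tensor {T : Type u} [Category.{v} T] [MonoidalCategory T] [SymmetricCategory T]
    (x y : Idem T) : IsLUB {x, y} (x.tensor y) := by
  obtain ⟨A, rfl⟩ := x.exists_mk
  obtain ⟨B, rfl⟩ := y.exists_mk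
  constructor
  · rintro _ (rfl | rfl)
    exacts [A.le_tensor_left B, A.le_tensor_right B]
  · intro z hz
    obtain ⟨C, rfl⟩ := z.exists_mk
    exact (IdempotentAlgebra.tensor_mono (hz (.inl rfl)) (hz (.inr rfl))).trans C.tensor_self_le

lemma Idem.tensor_eq_left {T : Type u} [Category.{v} T] [MonoidalCategory T] [SymmetricCategory T]
    {x y : Idem T} (h : y ≤ x) : x.tensor y = x :=
  (Idem.isLUB_tensor x y).unique (IsGreatest.isLUB ⟨.inl rfl, by simpa⟩)

lemma Idem.le_zero {T : Type u} [Category.{v} T] [Preadditive T] [HasZeroObject T] [HasShift T ℤ]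
    [∀ n : ℤ, (shiftFunctor T n).Additive] [Pretriangulated T] [MonoidalCategory T]
    [IsTensorTriangulated T] (x : Idem T) : x ≤ Idem.mk (IdempotentAlgebra.zero T) := by
  obtain ⟨A, rfl⟩ := x.exists_mk
  exact ⟨0, comp_zero⟩

/-- The isomorphism `B ⟶ B ⊗ B` factors through `A ⊗ B`, and a map `Y ⟶ B ⟶ A ⊗ B` factors through
`A ⊗ Y = 0`. -/
lemma rightOrthogonal_of_le {T : Type u} [Category.{v} T] [Preadditive T] [MonoidalCategory T]
    [SymmetricCategory T] {S : ObjectProperty T} {A : IdempotentAlgebra T} (hS : S ≤ A.annihilator)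
    {B : IdempotentAlgebra T} (h : A ≤ B) :
    S.rightOrthogonal B.obj := by
  obtain ⟨φ, hφ⟩ := h
  intro Y f hY
  have := (IdempotentAlgebra.isIso_whiskerRight_iff B.obj B.η).2 B.isIso
  have hB : B.unitMap B.obj = A.unitMap B.obj ≫ φ ▷ B.obj := by
    simp [IdempotentAlgebra.unitMap, ← hφ]
  have : IsIso (B.unitMap B.obj) := by
    rw [IdempotentAlgebra.unitMap]
    infer_instance
  rw [← cancel_mono (B.unitMap B.obj), hB, reassoc_of% A.unitMap_naturality f,
    (hS Y hY).eq_of_src (A.obj ◁ f) 0]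
  simp

/-- `B'` is local, so maps into it, and equations between them, lift uniquely along `L`. Nothing is
needed of `B`. -/
lemma map_le_map_iff {T : Type u} [Category.{v} T] [Preadditive T] [HasZeroObject T]
    [HasShift T ℤ] [∀ n : ℤ, (shiftFunctor T n).Additive] [Pretriangulated T]
    [MonoidalCategory T] [SymmetricCategory T] [IsTriangulated T]
    {S : ObjectProperty T} [S.IsTriangulated] {A : IdempotentAlgebra T}
    {K : Type u₂} [Category.{v₂} K] [MonoidalCategory K] (L : T ⥤ K) [L.IsLocalization S.trW]
    [L.Monoidal] (hS : S ≤ A.annihilator) {B B' : IdempotentAlgebra T}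
    (h' : A ≤ B') : B.map L ≤ B'.map L ↔ B ≤ B' := by
  refine ⟨?_, IdempotentAlgebra.map_mono L⟩
  rintro ⟨ψ, hψ⟩
  have hL := (rightOrthogonal_of_le hS h').map_bijective_of_isTriangulated L
  obtain ⟨φ, rfl⟩ := (hL _).2 ψ
  refine ⟨φ, (hL _).1 ?_⟩
  simp only [IdempotentAlgebra.map, Category.assoc] at hψ
  rwa [cancel_epi, ← L.map_comp] at hψ

lemma Idem.map_le_map_iff {T : Type u} [Category.{v} T] [Preadditive T] [HasZeroObject T]
    [HasShift T ℤ] [∀ n : ℤ, (shiftFunctor T n).Additive] [Pretriangulated T]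
    [MonoidalCategory T] [SymmetricCategory T] [IsTriangulated T]
    {S : ObjectProperty T} [S.IsTriangulated] {A : IdempotentAlgebra T}
    {K : Type u₂} [Category.{v₂} K] [MonoidalCategory K] (L : T ⥤ K) [L.IsLocalization S.trW]
    [L.Monoidal] (hS : S ≤ A.annihilator) (x : Idem T) {y : Idem T}
    (hy : Idem.mk A ≤ y) : Idem.map L x ≤ Idem.map L y ↔ x ≤ y := by
  obtain ⟨B, rfl⟩ := x.exists_mk
  obtain ⟨B', rfl⟩ := y.exists_mk
  exact TTGeometry.map_le_map_iff L hS hy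

section Localization

variable {T : Type u} [Category.{v} T] [Preadditive T] [HasZeroObject T] [HasShift T ℤ]
  [∀ n : ℤ, (shiftFunctor T n).Additive] [Pretriangulated T]
  [MonoidalCategory T] [SymmetricCategory T] [IsTriangulated T] [IsTensorTriangulated T]
  {S : ObjectProperty T} [S.IsTriangulated] [IsTensorIdeal S] {A : IdempotentAlgebra T}
  {K : Type u₂} [Category.{v₂} K] [MonoidalCategory K]
  (L : T ⥤ K) [L.IsLocalization S.trW] [L.Monoidal]

lemma rightOrthogonal_tensor_left (hA : A.Corresponds S) (hS : S ≤ A.annihilator) {X : T}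
    (hX : S.rightOrthogonal X) (Y : T) : S.rightOrthogonal (X ⊗ Y) :=
  have := isIso_unitMap hA hS hX
  S.rightOrthogonal.prop_of_iso ((α_ _ _ _).symm ≪≫ whiskerRightIso (asIso (A.unitMap X)).symm Y)
    (rightOrthogonal_tensor hS (X ⊗ Y))

/-- Lift the object to a local `X` and then the unit. The map `X ◁ η` joins local objects, on which
`L` is conservative, so idempotence lifts too. -/
lemma exists_map_antisymmRel (hA : A.Corresponds S) (hS : S ≤ A.annihilator)
    (E : IdempotentAlgebra K) :
    ∃ B : IdempotentAlgebra T, A ≤ B ∧ AntisymmRel (· ≤ ·) (B.map L) E := by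
  obtain ⟨X, hX, ⟨e⟩⟩ := exists_local_preimage L hA hS E.obj
  obtain ⟨η, hη⟩ := (hX.map_bijective_of_isTriangulated L (𝟙_ T)).2
    (Functor.OplaxMonoidal.η L ≫ E.η ≫ e.inv)
  have h₁ : IsIso (L.obj X ◁ L.map η) := by
    have := E.isIso
    have : IsIso (L.obj X ◁ E.η) := by
      have h : L.obj X ◁ E.η = e.hom ▷ _ ≫ E.obj ◁ E.η ≫ e.inv ▷ _ := by
        rw [← whisker_exchange_assoc]
        simp
      rw [h]
      infer_instance
    rw [hη, MonoidalCategory.whiskerLeft_comp, MonoidalCategory.whiskerLeft_comp]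
    infer_instance
  have h₂ : IsIso (L.map (X ◁ η)) := by
    rw [Functor.Monoidal.map_whiskerLeft]
    infer_instance
  have h₃ : IsIso (X ◁ η) := isIso_of_isIso_map L (rightOrthogonal_tensor_left hA hS hX _)
    (rightOrthogonal_tensor_left hA hS hX _) _
  have := isIso_unitMap hA hS hX
  let B : IdempotentAlgebra T := ⟨X, η, h₃⟩
  have : IsIso (A.unitMap B.obj) := isIso_unitMap hA hS hX
  exact ⟨B, IdempotentAlgebra.le_of_isIso_unitMap,
    ⟨e.hom, by simp [IdempotentAlgebra.map, B, hη]⟩, ⟨e.inv, by simp [IdempotentAlgebra.map, B, hη]⟩⟩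

lemma Idem.exists_map_eq (hA : A.Corresponds S) (hS : S ≤ A.annihilator) (y : Idem K) :
    ∃ x : Idem T, Idem.mk A ≤ x ∧ Idem.map L x = y := by
  obtain ⟨E, rfl⟩ := y.exists_mk
  obtain ⟨B, hB, h⟩ := exists_map_antisymmRel L hA hS E
  exact ⟨Idem.mk B, hB, Quotient.sound h⟩

end Localization

/-! ### Frame maps -/

lemma isFrameMap_orderIso {P Q : Type*} [PartialOrder P] [PartialOrder Q] (e : P ≃o Q) :
    IsFrameMap e where
  isLUB _ _ h := (OrderIso.isLUB_image' e).2 h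
  isGLB _ _ _ h := (OrderIso.isGLB_image' e).2 h

section OpensExtension

variable {X : Type*} [TopologicalSpace X] (U : Opens X)

/-- The largest open subset of `X` with a given trace on the complement of `U`. -/
def opensExtension (V : Opens ((U : Set X)ᶜ : Set X)) : Opens X where
  carrier := (Subtype.val '' (V : Set ((U : Set X)ᶜ : Set X))ᶜ)ᶜ
  is_open' := (U.isOpen.isClosed_compl.isClosedMap_subtype_val _ V.isOpen.isClosed_compl).isOpen_compl

lemma coe_opensExtension (V : Opens ((U : Set X)ᶜ : Set X)) :
    (opensExtension U V : Set X) = (Subtype.val '' (V : Set ((U : Set X)ᶜ : Set X))ᶜ)ᶜ := rfl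

lemma mem_opensExtension {V : Opens ((U : Set X)ᶜ : Set X)} {x : X} :
    x ∈ opensExtension U V ↔ ∀ hx : x ∉ U, (⟨x, hx⟩ : ((U : Set X)ᶜ : Set X)) ∈ V := by
  rw [← SetLike.mem_coe, coe_opensExtension]
  simp only [Set.mem_compl_iff, Set.mem_image, Subtype.exists, exists_and_right, exists_eq_right,
    not_exists, SetLike.mem_coe, not_not]

/-- As a right adjoint, extension preserves meets. -/
lemma gc_opensExtension : GaloisConnection
    (fun W : Opens X ↦ (W.comap ⟨Subtype.val, continuous_subtype_val⟩ :
      Opens ((U : Set X)ᶜ : Set X))) (opensExtension U) := fun _ _ ↦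
  ⟨fun h x hx ↦ (mem_opensExtension U).2 fun hx' ↦ h (show (⟨x, hx'⟩ : ((U : Set X)ᶜ : Set X)) ∈ _ from hx),
    fun h x hx ↦ (mem_opensExtension U).1 (h hx) x.2⟩

lemma comap_opensExtension (V : Opens ((U : Set X)ᶜ : Set X)) :
    (opensExtension U V).comap ⟨Subtype.val, continuous_subtype_val⟩ = V := by
  ext x
  exact (mem_opensExtension U).trans ⟨fun h ↦ h x.2, fun h _ ↦ h⟩

lemma opensExtension_comap (W : Opens X) :
    opensExtension U (W.comap ⟨Subtype.val, continuous_subtype_val⟩) = W ⊔ U := by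
  ext x
  refine (mem_opensExtension U).trans (Iff.trans ?_ or_comm)
  exact (or_iff_not_imp_left (a := x ∈ U) (b := x ∈ W)).symm

/-- `U` is inserted for the sake of the empty join: the empty open of the closed subset extends to
`U`. -/
lemma isLUB_opensExtension {s : Set (Opens ((U : Set X)ᶜ : Set X))}
    {V : Opens ((U : Set X)ᶜ : Set X)} (h : IsLUB s V) :
    IsLUB (insert U (opensExtension U '' s)) (opensExtension U V) := by
  have hU (V) : U ≤ opensExtension U V := fun x hx ↦ (mem_opensExtension U).2 fun h ↦ (h hx).elim
  refine ⟨?_, fun W hW ↦ ?_⟩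
  · rintro _ (rfl | ⟨V', hV', rfl⟩)
    exacts [hU V, (gc_opensExtension U).monotone_u (h.1 hV')]
  · rw [← sup_eq_left.2 (hW (.inl rfl)), ← opensExtension_comap]
    refine (gc_opensExtension U).monotone_u (h.2 fun V' hV' ↦ ?_)
    rw [← comap_opensExtension U V']
    exact (gc_opensExtension U).monotone_l (hW (.inr ⟨V', hV', rfl⟩))

end OpensExtension

/-- A frame map on open sets descends to a closed subset along a map `F` which identifies
the target with the elements above the image of the open complement. -/
theorem existsUnique_isFrameMap {X : Type*} [TopologicalSpace X] {P Q : Type*} [PartialOrder P]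
    [PartialOrder Q] {τ : Opens X → P} (hτ : IsFrameMap τ) (U : Opens X) (F : P → Q) (j : P → P)
    (hj : ∀ x, IsLUB {x, τ U} (j x)) (hFj : ∀ x, F (j x) = F x)
    (hF : ∀ x y, τ U ≤ x → τ U ≤ y → (F x ≤ F y ↔ x ≤ y))
    (hF' : ∀ q, ∃ x, τ U ≤ x ∧ F x = q) :
    ∃! τ' : Opens ((U : Set X)ᶜ : Set X) → Q,
      IsFrameMap τ' ∧ (Function.Injective τ → Function.Injective τ') ∧
        ∀ W : Opens X, τ' (W.comap ⟨Subtype.val, continuous_subtype_val⟩) = F (τ W) := by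
  have hU (V) : τ U ≤ τ (opensExtension U V) :=
    (hτ.isLUB _ _ (isLUB_opensExtension U isLUB_singleton)).1 ⟨U, .inl rfl, rfl⟩
  refine ⟨fun V ↦ F (τ (opensExtension U V)), ⟨⟨?_, ?_⟩, ?_, ?_⟩, ?_⟩
  · intro s V hV
    have h := hτ.isLUB _ _ (isLUB_opensExtension U hV)
    refine ⟨?_, fun q hq ↦ ?_⟩
    · rintro _ ⟨V', hV', rfl⟩
      exact (hF _ _ (hU _) (hU _)).2 (h.1 ⟨_, .inr ⟨V', hV', rfl⟩, rfl⟩)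
    · obtain ⟨x, hx, rfl⟩ := hF' q
      refine (hF _ _ (hU _) hx).2 (h.2 ?_)
      rintro _ ⟨_, rfl | ⟨V', hV', rfl⟩, rfl⟩
      exacts [hx, (hF _ _ (hU _) hx).1 (hq ⟨V', hV', rfl⟩)]
  · intro s V hs hV
    have h := hτ.isGLB _ _ (hs.image _) ((gc_opensExtension U).isGLB_u_image hV)
    refine ⟨?_, fun q hq ↦ ?_⟩
    · rintro _ ⟨V', hV', rfl⟩
      exact (hF _ _ (hU _) (hU _)).2 (h.1 ⟨_, ⟨V', hV', rfl⟩, rfl⟩)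
    · obtain ⟨x, hx, rfl⟩ := hF' q
      refine (hF _ _ hx (hU _)).2 (h.2 ?_)
      rintro _ ⟨_, ⟨V', hV', rfl⟩, rfl⟩
      exact (hF _ _ hx (hU _)).1 (hq ⟨V', hV', rfl⟩)
  · intro h V V' hV
    have := h (le_antisymm ((hF _ _ (hU V) (hU V')).1 hV.le) ((hF _ _ (hU V') (hU V)).1 hV.ge))
    rw [← comap_opensExtension U V, this, comap_opensExtension]
  · intro W
    have h := hτ.isLUB _ _ (isLUB_pair (a := W) (b := U))
    rw [Set.image_pair] at h
    simp only [opensExtension_comap]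
    -- `τ (W ⊔ U)` is the join of `τ W` and `τ U`, which `F` does not distinguish from `τ W`.
    rw [h.unique (hj _), hFj]
  -- Every open of the closed subset is a trace, so the formula on traces determines `τ'`.
  · rintro τ' ⟨-, -, h⟩
    funext V
    rw [← h, comap_opensExtension]

end TTGeometry

theorem mainTheorem9 {T : Type u} [Category.{v} T] [Preadditive T] [HasZeroObject T]
    [HasShift T ℤ] [∀ n : ℤ, (shiftFunctor T n).Additive] [Pretriangulated T]
    [MonoidalCategory T] [SymmetricCategory T] [IsBigTTCategory.{w} T] :
    -- the quotient by a smashing ideal, and its idempotent algebras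
    (∀ (S : ObjectProperty T) [S.IsTriangulated] [IsTensorIdeal S] (A : IdempotentAlgebra T),
      IsSmashing.{w} S → A.Corresponds S →
        IsBigTTCategory.{w} (TTQuotient S) ∧
        ∃ e : Set.Icc (Idem.mk A) (Idem.mk (IdempotentAlgebra.zero T)) ≃o Idem (TTQuotient S),
          IsFrameMap e ∧ IsFrameMap e.symm ∧
          ∀ B, e B = Idem.map (TTQuotient.functor S) (B.1.tensor (Idem.mk A))) ∧
    -- the induced categorified frame on a closed subset
    (∀ (X : Type*) [TopologicalSpace X] (τ : Opens X → Idem T) (U : Opens X)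
      (A : IdempotentAlgebra T), IsFrameMap τ → τ U = Idem.mk A →
        IsBigTTCategory.{w} (TTQuotient A.annihilator) ∧
        ∃! τ' : Opens ((U : Set X)ᶜ : Set X) → Idem (TTQuotient A.annihilator),
          IsFrameMap τ' ∧ (Function.Injective τ → Function.Injective τ') ∧
          ∀ W : Opens X,
            τ' (W.comap ⟨Subtype.val, continuous_subtype_val⟩) =
              Idem.map (TTQuotient.functor A.annihilator) ((τ W).tensor (Idem.mk A))) := by
  have key (S : ObjectProperty T) [S.IsTriangulated] [IsTensorIdeal S] {A : IdempotentAlgebra T}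
      (hS : S ≤ A.annihilator) (x y : Idem T) (hx : Idem.mk A ≤ x) (hy : Idem.mk A ≤ y) :
      Idem.map (TTQuotient.functor S) (x.tensor (Idem.mk A)) ≤
        Idem.map (TTQuotient.functor S) (y.tensor (Idem.mk A)) ↔ x ≤ y := by
    rw [Idem.tensor_eq_left hx, Idem.tensor_eq_left hy, Idem.map_le_map_iff _ hS _ hy]
  have key' (S : ObjectProperty T) [S.IsTriangulated] [IsTensorIdeal S] {A : IdempotentAlgebra T}
      (hS : S ≤ A.annihilator) (hA : A.Corresponds S) (y : Idem (TTQuotient S)) :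
      ∃ x : Idem T, Idem.mk A ≤ x ∧
        Idem.map (TTQuotient.functor S) (x.tensor (Idem.mk A)) = y := by
    obtain ⟨x, hx, rfl⟩ := Idem.exists_map_eq (TTQuotient.functor S) hA hS y
    exact ⟨x, hx, by rw [Idem.tensor_eq_left hx]⟩
  refine ⟨fun S _ _ A hS hA ↦ ?_, fun X _ τ U A hτ hU ↦ ?_⟩
  · have hS' := hS.le_annihilator hA
    refine ⟨isBigTTCategory_of_localization hA hS' (TTQuotient.functor S), ?_⟩
    let f : Set.Icc (Idem.mk A) (Idem.mk (IdempotentAlgebra.zero T)) ↪o Idem (TTQuotient S) :=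
      OrderEmbedding.ofMapLEIff
        (fun B ↦ Idem.map (TTQuotient.functor S) (B.1.tensor (Idem.mk A)))
        fun B B' ↦ key S hS' B.1 B'.1 B.2.1 B'.2.1
    have hf : Function.Surjective f := fun y ↦ by
      obtain ⟨x, hx, h⟩ := key' S hS' hA y
      -- The zero algebra is the top element, so the interval consists of everything above `A`.
      exact ⟨⟨x, hx, x.le_zero⟩, h⟩
    let e := RelIso.ofSurjective f hf
    exact ⟨e, isFrameMap_orderIso e, isFrameMap_orderIso e.symm, fun _ ↦ rfl⟩
  · have hA := A.corresponds_annihilator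
    refine ⟨isBigTTCategory_of_localization hA le_rfl (TTQuotient.functor _), ?_⟩
    refine existsUnique_isFrameMap hτ U
      (fun x ↦ Idem.map (TTQuotient.functor A.annihilator) (x.tensor (Idem.mk A)))
      (fun x ↦ x.tensor (Idem.mk A)) ?_ ?_ ?_ ?_
    · exact fun x ↦ hU ▸ Idem.isLUB_tensor x (Idem.mk A)
    · intro x
      have h : Idem.mk A ≤ x.tensor (Idem.mk A) := (Idem.isLUB_tensor x _).1 (.inr rfl)
      simp only [Idem.tensor_eq_left h]
    · rw [hU]
      exact key _ le_rfl
    · rw [hU]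
      exact key' _ le_rfl hA
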